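/- Let $Q$ be a primitive zero-one $q\times q$ matrix and let $\hat\Sigma\subset\{1,\dots,q\}^{\mathbb Z}$ be the associated topologically mixing two-sided subshift, i.e. the set of sequences $\hat x=(x_i)_{i\in\mathbb Z}$ with $Q_{x_i x_{i+1}}=1$ for all $i$, with the left shift $T$ and the metric $\iota(\hat x,\hat y)=2^{-k}$, where $k$ is the largest integer such that $x_j=y_j$ for all $|j|\le k$. Let $\Sigma^-$ and $\Sigma$ be the one-sided subshifts in coordinates $\le 0$ and $\ge 0$, let $\pi^-:\hat\Sigma\to\Sigma^-$, $\pi:\hat\Sigma\to\Sigma$ be the projections, and write $x^-=\pi^-(\hat x)$. The map $(\pi^-,\pi)$ identifies each cylinder $[\xi]=\{\hat x: x_0=\xi\}$ with the product of the corresponding cylinders of $\Sigma^-$ and $\Sigma$. Let $\hat\mu$ be a $T$-invariant ergodic Borel probability measure on $\hat\Sigma$ with full support and with continuous local product structure with Hölder density: there is a continuous function $\psi:\hat\Sigma\to(0,\infty)$, Hölder with respect to $\iota$, such that on each cylinder $[\xi]$ one has $d\hat\mu=\psi|_{[\xi]}\,d(\mu^-\times\mu)$, where $\mu^-=\pi^-_*\hat\mu$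 and $\mu=\pi_*\hat\mu$. Let $A:\hat\Sigma\to GL(d,\mathbb R)$ be a 2-step cocycle, i.e. $A(\hat x)$ depends only on $(x_0,x_1)$, and put $A^{(n)}(\hat x)=A(T^{n-1}\hat x)\cdots A(\hat x)$. Assume the following. (a) $A$ is strongly irreducible: there are no $1\le l\le d-1$, $k\ge 1$ and maps $V_1,\dots,V_k:\hat\Sigma\to\mathrm{Grass}(l,\mathbb R^d)$, each depending only on $x_0$, with $A(\hat x)\bigl(V_1(\hat x)\cup\dots\cup V_k(\hat x)\bigr)=V_1(T\hat x)\cup\dots\cup V_k(T\hat x)$ for all $\hat x\in\hat\Sigma$. (b) The first Lyapunov exponent is simple: $\lambda_1>\lambda_2$, where $\lambda_j$ is the $\hat\mu$-almost sure limit of $\frac1n\log a_j(A^{(n)}(\hat x))$ and $a_1\ge a_2\ge\cdots$ denote singular values (no condition on $\lambda_2$ if $d=1$). Let $\hat m$ be an invariant s-state, i.e. a Borel probability measure on $\hat\Sigma\times\mathbb{RP}^{d-1}$ which projects to $\hat\mu$, is invariant under $(\hat x,[v])\mapsto(T\hat x,[A(\hat x)v])$, and has a disintegration $(\hat m_{\hat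 x})_{\hat x\in\hat\Sigma}$ over $\hat\mu$ into probability measures such that $\hat m_{\hat x}=\hat m_{\hat y}$ whenever $x_i=y_i$ for all $i\ge 0$. Let $m$ be the image of $\hat m$ under $(\hat x,[v])\mapsto(x^-,[v])$. Then $m$ has a disintegration $(m_{x^-})_{x^-\in\Sigma^-}$ over $\mu^-$ into probability measures on $\mathbb{RP}^{d-1}$ which is continuous, i.e. $x^-\mapsto\int g\,dm_{x^-}$ is continuous for every continuous $g:\mathbb{RP}^{d-1}\to\mathbb R$; and for every such continuous disintegration, $m_{x^-}(V)=0$ for every $x^-\in\Sigma^-$ and every proper projective subspace $V\subsetneq\mathbb{RP}^{d-1}$. -/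

import Mathlib

open MeasureTheory ProbabilityTheory Filter Topology
open scoped LinearAlgebra.Projectivization

noncomputable section

namespace ShiftCocycle

/-! ### Subshifts of finite type with memory one -/

/-- `Q` is a zero-one adjacency matrix which is primitive (equivalently, the subshift it defines
is topologically mixing). -/
structure IsMixingAdjacency {q : ℕ} (Q : Matrix (Fin q) (Fin q) ℤ) : Prop where
  zero_one : ∀ i j, Q i j = 0 ∨ Q i j = 1
  primitive : Q.IsPrimitive

variable {q : ℕ} {Q : Matrix (Fin q) (Fin q) ℤ}

/-- The two-sided subshift: bi-infinite sequences all of whose transitions are allowed by `Q`.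
It carries the product topology and the corresponding Borel σ-algebra. -/
abbrev TwoSided (Q : Matrix (Fin q) (Fin q) ℤ) : Type :=
  {x : ℤ → Fin q // ∀ i, Q (x i) (x (i + 1)) = 1}

/-- The one-sided subshift to the right: `y n` is the symbol in position `n ≥ 0`. -/
abbrev RightSided (Q : Matrix (Fin q) (Fin q) ℤ) : Type :=
  {y : ℕ → Fin q // ∀ n, Q (y n) (y (n + 1)) = 1}

/-- The one-sided subshift to the left: `y n` is the symbol in position `-n ≤ 0`. -/
abbrev LeftSided (Q : Matrix (Fin q) (Fin q) ℤ) : Type :=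
  {y : ℕ → Fin q // ∀ n, Q (y (n + 1)) (y n) = 1}

/-- The left shift `T` on the two-sided subshift. -/
def shift (x : TwoSided Q) : TwoSided Q :=
  ⟨fun i => x.1 (i + 1), fun i => x.2 (i + 1)⟩

/-- Projection to the nonnegative coordinates. -/
def projRight (x : TwoSided Q) : RightSided Q :=
  ⟨fun n => x.1 n, fun n => by simpa using x.2 n⟩

/-- Projection to the nonpositive coordinates. -/
def projLeft (x : TwoSided Q) : LeftSided Q :=
  ⟨fun n => x.1 (-(n : ℤ)), fun n => by
    have h := x.2 (-((n : ℤ) + 1))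
    have e : -((n : ℤ) + 1) + 1 = -(n : ℤ) := by ring
    rw [e] at h
    simpa using h⟩

/-- The map `x ↦ (x⁻, x⁺)`, both halves containing the zeroth coordinate. It identifies each
cylinder `[ξ]` with the product of the corresponding one-sided cylinders. -/
def split (x : TwoSided Q) : LeftSided Q × RightSided Q := (projLeft x, projRight x)

/-- The cylinder of sequences with zeroth symbol `ξ`. -/
def cylinder (Q : Matrix (Fin q) (Fin q) ℤ) (ξ : Fin q) : Set (TwoSided Q) := {x | x.1 0 = ξ}

/-- `y` lies in the local stable set of `x`. -/
def SameStable (x y : TwoSided Q) : Prop := ∀ i : ℤ, 0 ≤ i → x.1 i = y.1 i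

/-- The metric `ι(x, y) = 2 ^ (-k)`, where `k` is the largest integer such that `x j = y j`
whenever `|j| ≤ k`; that is, `k + 1` is the least `|j|` with `x j ≠ y j`. -/
def shiftDist (x y : TwoSided Q) : ℝ :=
  open Classical in
  if x = y then 0
  else (2 : ℝ) ^ (-((sInf {n : ℕ | ∃ j : ℤ, j.natAbs = n ∧ x.1 j ≠ y.1 j} : ℕ) - 1 : ℤ))

/-- Hölder continuity with respect to `shiftDist`. -/
def IsHolder (ψ : TwoSided Q → ℝ) : Prop :=
  ∃ C α : ℝ, 0 < α ∧ ∀ x y, |ψ x - ψ y| ≤ C * shiftDist x y ^ α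

/-- The splitting map is a measurable embedding, so that measures can be pulled back along it. -/
theorem measurableEmbedding_split : MeasurableEmbedding (split (Q := Q)) := by
  have hc : Continuous (split (Q := Q)) := by
    unfold split projLeft projRight
    refine Continuous.prodMk ?_ ?_ <;>
    · refine Continuous.subtype_mk (continuous_pi fun n => ?_) _
      exact (continuous_apply _).comp continuous_subtype_val
  have hi : Function.Injective (split (Q := Q)) := by
    intro x y h
    have h1 : projLeft x = projLeft y := congrArg Prod.fst h
    have h2 : projRight x = projRight y := congrArg Prod.snd h
    apply Subtype.ext
    funext i
    obtain ⟨n, rfl | rfl⟩ := i.eq_nat_or_neg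
    · exact congrFun (congrArg Subtype.val h2) n
    · exact congrFun (congrArg Subtype.val h1) n
  have hcl : IsClosed {x : ℤ → Fin q | ∀ i, Q (x i) (x (i + 1)) = 1} := by
    rw [Set.ofPred_forall]
    refine isClosed_iInter fun i => ?_
    have hcont : Continuous fun x : ℤ → Fin q => (x i, x (i + 1)) :=
      (continuous_apply i).prodMk (continuous_apply (i + 1))
    exact (isClosed_discrete {p : Fin q × Fin q | Q p.1 p.2 = 1}).preimage hcont
  have : CompactSpace (TwoSided Q) := isCompact_iff_compactSpace.mp hcl.isCompact
  have : SecondCountableTopology (LeftSided Q) :=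
    TopologicalSpace.Subtype.secondCountableTopology {y : ℕ → Fin q | ∀ n, Q (y (n + 1)) (y n) = 1}
  exact (hc.isClosedEmbedding hi).measurableEmbedding

/-- Continuous local product structure with Hölder density: `μ` is ergodic for the shift and there
is a positive continuous Hölder function `ψ` such that on every cylinder `[ξ]` one has
`dμ = ψ d(μ⁻ × μ⁺)`, where `μ⁻`, `μ⁺` are the projections of `μ`, and `[ξ]` is identified with a
subset of the product of the one-sided shifts by `split`. -/
structure HasHolderProductStructure (μ : Measure (TwoSided Q)) : Prop where
  ergodic : Ergodic shift μ
  exists_density : ∃ ψ : TwoSided Q → ℝ, Continuous ψ ∧ (∀ x, 0 < ψ x) ∧ IsHolder ψ ∧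
    ∀ ξ : Fin q, μ.restrict (cylinder Q ξ) =
      ((((μ.map projLeft).prod (μ.map projRight)).comap split).restrict
        (cylinder Q ξ)).withDensity fun x => ENNReal.ofReal (ψ x)

/-! ### Linear cocycles -/

/-- `ℝ^d` with its Euclidean norm. -/
abbrev E (d : ℕ) : Type := EuclideanSpace ℝ (Fin d)

variable {d : ℕ}

/-- The linear map of an invertible matrix. -/
def act (g : Matrix.GeneralLinearGroup (Fin d) ℝ) : E d →ₗ[ℝ] E d :=
  Matrix.toEuclideanLin (g : Matrix (Fin d) (Fin d) ℝ)

theorem act_injective (g : Matrix.GeneralLinearGroup (Fin d) ℝ) :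
    Function.Injective (act g) := by
  intro v w h
  have h' : (g : Matrix (Fin d) (Fin d) ℝ).mulVec v.ofLp
      = (g : Matrix (Fin d) (Fin d) ℝ).mulVec w.ofLp := congrArg WithLp.ofLp h
  have hu : IsUnit (g : Matrix (Fin d) (Fin d) ℝ) := g.isUnit
  exact WithLp.ofLp_injective 2 (Matrix.mulVec_injective_iff_isUnit.mpr hu h')

/-- The cocycle depends only on the symbols in positions `0` and `1`. -/
def IsTwoStep (A : TwoSided Q → Matrix.GeneralLinearGroup (Fin d) ℝ) : Prop :=
  ∀ x y, x.1 0 = y.1 0 → x.1 1 = y.1 1 → A x = A y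

/-- `A⁽ⁿ⁾(x) = A(Tⁿ⁻¹ x) ⋯ A(x)`. -/
def cocycleProd (A : TwoSided Q → Matrix.GeneralLinearGroup (Fin d) ℝ) :
    ℕ → TwoSided Q → Matrix.GeneralLinearGroup (Fin d) ℝ
  | 0, _ => 1
  | n + 1, x => A (shift^[n] x) * cocycleProd A n x

/-- `χ` is the almost sure limit of `n⁻¹ log aⱼ₊₁(A⁽ⁿ⁾(x))`, where `a₁ ≥ a₂ ≥ ⋯` are the singular
values (which Mathlib indexes from `0`). -/
def IsLyapunovExponent (μ : Measure (TwoSided Q))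
    (A : TwoSided Q → Matrix.GeneralLinearGroup (Fin d) ℝ) (j : ℕ) (χ : ℝ) : Prop :=
  ∀ᵐ x ∂μ, Tendsto
    (fun n : ℕ => (n : ℝ)⁻¹ * Real.log ((act (cocycleProd A n x)).singularValues j)) atTop (𝓝 χ)

/-- The first Lyapunov exponent is simple: `χ₁ > χ₂` (no condition on `χ₂` if `d ≤ 1`). -/
def HasSimpleTopExponent (μ : Measure (TwoSided Q))
    (A : TwoSided Q → Matrix.GeneralLinearGroup (Fin d) ℝ) : Prop :=
  ∃ χ₁ : ℝ, IsLyapunovExponent μ A 0 χ₁ ∧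
    (2 ≤ d → ∃ χ₂ : ℝ, IsLyapunovExponent μ A 1 χ₂ ∧ χ₂ < χ₁)

/-- Strong irreducibility: there is no nonempty finite family of maps `V₁, …, Vₘ` to a
Grassmannian of `l`-planes with `1 ≤ l ≤ d - 1`, each depending only on the zeroth symbol, such that
`A(x)(V₁(x) ∪ ⋯ ∪ Vₘ(x)) = V₁(Tx) ∪ ⋯ ∪ Vₘ(Tx)` for every `x`. -/
def IsStronglyIrreducible (A : TwoSided Q → Matrix.GeneralLinearGroup (Fin d) ℝ) : Prop :=
  ¬ ∃ (l m : ℕ) (V : Fin m → TwoSided Q → Submodule ℝ (E d)),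
    1 ≤ l ∧ l < d ∧ 1 ≤ m ∧
    (∀ i x, Module.finrank ℝ (V i x) = l) ∧
    (∀ i x y, x.1 0 = y.1 0 → V i x = V i y) ∧
    ∀ x, act (A x) '' (⋃ i, (V i x : Set (E d))) = ⋃ i, (V i (shift x) : Set (E d))

/-! ### Projective space and s-states -/

/-- Real projective space of dimension `d - 1`. -/
abbrev RP (d : ℕ) : Type := ℙ ℝ (E d)

/-- The quotient topology from `ℝ^d ∖ {0}`. -/
instance instTopologicalSpaceRP (d : ℕ) : TopologicalSpace (RP d) :=
  TopologicalSpace.coinduced (Projectivization.mk' ℝ) inferInstance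

instance instMeasurableSpaceRP (d : ℕ) : MeasurableSpace (RP d) := borel (RP d)

instance instBorelSpaceRP (d : ℕ) : BorelSpace (RP d) := ⟨rfl⟩

/-- The projective skew product `F_A(x, [v]) = (T x, [A(x) v])`. -/
def skewProduct (A : TwoSided Q → Matrix.GeneralLinearGroup (Fin d) ℝ)
    (p : TwoSided Q × RP d) : TwoSided Q × RP d :=
  (shift p.1, Projectivization.map (act (A p.1)) (act_injective (A p.1)) p.2)

/-- Invariant s-states: probability measures projecting to `μ`, invariant under the skew product,
and having a disintegration over `μ` which is constant on local stable sets. -/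
structure IsInvariantSState (μ : Measure (TwoSided Q))
    (A : TwoSided Q → Matrix.GeneralLinearGroup (Fin d) ℝ)
    (m : Measure (TwoSided Q × RP d)) : Prop where
  isProbability : IsProbabilityMeasure m
  map_fst : m.map Prod.fst = μ
  invariant : m.map (skewProduct A) = m
  exists_disintegration : ∃ κ : Kernel (TwoSided Q) (RP d), IsMarkovKernel κ ∧
    m = μ.compProd κ ∧ ∀ x y, SameStable x y → κ y = κ x

/-- The projection `Π(x, [v]) = (x⁻, [v])` applied to a measure. -/
def projectMeasure (m : Measure (TwoSided Q × RP d)) : Measure (LeftSided Q × RP d) :=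
  m.map fun p => (projLeft p.1, p.2)

/-- `κ` is a disintegration of `m` over its projection to the left-sided shift into probability
measures which depend continuously on the base point for the weak topology. -/
structure IsContinuousDisintegration (m : Measure (LeftSided Q × RP d))
    (κ : Kernel (LeftSided Q) (RP d)) : Prop where
  isMarkov : IsMarkovKernel κ
  disintegrates : m = (m.map Prod.fst).compProd κ
  continuous : ∀ g : C(RP d, ℝ), Continuous fun x => ∫ v, g v ∂(κ x)

end ShiftCocycle

end

noncomputable section

namespace ShiftCocycle

variable {q : ℕ} {Q : Matrix (Fin q) (Fin q) ℤ} {d : ℕ}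

/-! ### Topology of projective space -/

/-! The conditional measure at a past `x` is the average of the measures `κ₀` of the s-state over
the futures `y` compatible with `x`, with weight `ψ (x, y)`. An s-state does not see the past, so
`x` enters only through the weight, and Hölder continuity of `ψ` bounds the change of the average,
uniformly over all measurable sets. Hence the averages `K x` form a continuous disintegration, in a
sense strong enough to compare masses of subspaces (`lintegral_pastKernel_le_add`).

Invariance under the skew product makes `K x` a convex combination, up to arbitrarily small errors,
of pullbacks of `K (append x j)` by the cocycle, with weights bounded below independently of the
error (`exists_weights`). Suppose some proper subspace has positive mass. Take the least dimension
`l` where this happens and the largest mass `γ` of an `l`-plane. It is attained, by compactness of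
the space of pasts and because `l`-planes of mass at least `γ / 2` are finite in number
(`exists_maximal_mass`). A convex combination reaches `γ` only if every term does, so maximal planes
are carried to maximal planes. Two pasts with the same last symbol become close after equal symbols
are appended, so the set of maximal planes depends only on that symbol. These finite sets are
permuted by the cocycle, contradicting strong irreducibility. Full support makes any continuous
disintegration agree with `K` on subspaces (`measureReal_projectivization_unique`). -/

theorem continuous_mk' (d : ℕ) :
    Continuous (Projectivization.mk' ℝ : {v : E d // v ≠ 0} → RP d) :=
  continuous_coinduced_rng

/-- The unit sphere maps onto it. Compactness makes continuous functions bounded, hence integrable.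
-/
instance instCompactSpaceRP (d : ℕ) : CompactSpace (RP d) := by
  let f : Metric.sphere (0 : E d) 1 → RP d := fun v =>
    Projectivization.mk' ℝ ⟨v.1, fun h => by simpa [h] using v.2⟩
  have hf : Continuous f :=
    (continuous_mk' d).comp (continuous_subtype_val.subtype_mk _)
  have hs : Function.Surjective f := by
    intro p
    induction p using Projectivization.ind with
    | h v hv =>
      have hn : ‖v‖ ≠ 0 := norm_ne_zero_iff.mpr hv
      refine ⟨⟨‖v‖⁻¹ • v, by simp [norm_smul, hn]⟩, ?_⟩
      refine (Projectivization.mk_eq_mk_iff' ℝ _ _ _ _).mpr ⟨‖v‖⁻¹, rfl⟩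
  have : CompactSpace (Metric.sphere (0 : E d) 1) :=
    isCompact_iff_compactSpace.mp (isCompact_sphere _ _)
  exact hs.compactSpace hf

/-- The squared sine of the angle between a line and the subspace `W`. -/
def sinSq (W : Submodule ℝ (E d)) : C(RP d, ℝ) where
  toFun := Projectivization.lift (fun v => ‖Wᗮ.starProjection v.1‖ ^ 2 / ‖v.1‖ ^ 2) (by
    rintro ⟨v, hv⟩ ⟨w, hw⟩ t rfl
    have ht : t ≠ 0 := fun h => hv (by simp [h])
    have hn : ‖w‖ ≠ 0 := norm_ne_zero_iff.mpr hw
    simp only [map_smul, norm_smul]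
    have ht' : ‖t‖ ≠ 0 := norm_ne_zero_iff.mpr ht
    field_simp)
  continuous_toFun := by
    refine continuous_coinduced_dom.mpr ?_
    change Continuous fun v : {v : E d // v ≠ 0} => ‖Wᗮ.starProjection v.1‖ ^ 2 / ‖v.1‖ ^ 2
    refine Continuous.div (by fun_prop) (by fun_prop) fun v => ?_
    exact pow_ne_zero 2 (norm_ne_zero_iff.mpr v.2)

theorem sinSq_nonneg (W : Submodule ℝ (E d)) (p : RP d) : 0 ≤ sinSq W p := by
  induction p using Projectivization.ind with
  | h v hv =>
    change 0 ≤ ‖Wᗮ.starProjection v‖ ^ 2 / ‖v‖ ^ 2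
    positivity

theorem sinSq_eq_zero_iff (W : Submodule ℝ (E d)) (p : RP d) :
    sinSq W p = 0 ↔ p ∈ W.projectivization := by
  induction p using Projectivization.ind with
  | h v hv =>
    rw [Submodule.mk_mem_projectivization_iff]
    change ‖Wᗮ.starProjection v‖ ^ 2 / ‖v‖ ^ 2 = 0 ↔ _
    have hn : ‖v‖ ≠ 0 := norm_ne_zero_iff.mpr hv
    rw [div_eq_zero_iff, or_iff_left (pow_ne_zero 2 hn), pow_eq_zero_iff two_ne_zero,
      norm_eq_zero, Submodule.starProjection_apply_eq_zero_iff, Submodule.orthogonal_orthogonal]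

theorem measurableSet_projectivization (W : Submodule ℝ (E d)) :
    MeasurableSet (W.projectivization : Set (RP d)) := by
  have : (W.projectivization : Set (RP d)) = sinSq W ⁻¹' {0} := by
    ext p
    exact (sinSq_eq_zero_iff W p).symm
  rw [this]
  exact (isClosed_singleton.preimage (sinSq W).continuous).measurableSet

/-- Continuous functions decreasing to the indicator of the projective subspace of `W`. -/
def bump (W : Submodule ℝ (E d)) (n : ℕ) : C(RP d, ℝ) where
  toFun p := max 0 (1 - n * sinSq W p)
  continuous_toFun := by fun_prop

theorem bump_nonneg (W : Submodule ℝ (E d)) (n : ℕ) (p : RP d) : 0 ≤ bump W n p :=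
  le_max_left _ _

theorem bump_le_one (W : Submodule ℝ (E d)) (n : ℕ) (p : RP d) : bump W n p ≤ 1 :=
  max_le zero_le_one (by
    have := sinSq_nonneg W p
    have : 0 ≤ n * sinSq W p := by positivity
    linarith)

theorem bump_of_mem {W : Submodule ℝ (E d)} {p : RP d} (hp : p ∈ W.projectivization) (n : ℕ) :
    bump W n p = 1 := by
  change max 0 (1 - n * sinSq W p) = 1
  simp [(sinSq_eq_zero_iff W p).mpr hp]

theorem tendsto_bump (W : Submodule ℝ (E d)) (p : RP d) :
    Tendsto (fun n => bump W n p) atTop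
      (𝓝 ((W.projectivization : Set (RP d)).indicator 1 p)) := by
  by_cases hp : p ∈ W.projectivization
  · rw [Set.indicator_of_mem (by exact hp)]
    simp [bump_of_mem hp]
  · rw [Set.indicator_of_notMem (by exact hp)]
    have hs : 0 < sinSq W p :=
      lt_of_le_of_ne (sinSq_nonneg W p) (Ne.symm (mt (sinSq_eq_zero_iff W p).mp hp))
    refine tendsto_const_nhds.congr' ?_
    obtain ⟨N, hN⟩ := exists_nat_gt (sinSq W p)⁻¹
    filter_upwards [eventually_ge_atTop N] with n hn
    have h1 : (sinSq W p)⁻¹ < n := hN.trans_le (by exact_mod_cast hn)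
    have h2 : 1 < n * sinSq W p := by
      rwa [inv_lt_iff_one_lt_mul₀ hs] at h1
    exact (max_eq_left (by linarith)).symm

/-! ### Combinatorics of the subshift -/

/-- A positive entry of `Q ^ k` is an admissible path of length `k`, along which membership in `S`
propagates; primitivity links all pairs of symbols. -/
theorem IsMixingAdjacency.eq_univ_of_closed (hQ : IsMixingAdjacency Q) {S : Set (Fin q)}
    (hS : S.Nonempty) (hc : ∀ i ∈ S, ∀ j, Q i j = 1 → j ∈ S) : S = Set.univ := by
  have key : ∀ k : ℕ, ∀ i ∈ S, ∀ j, 0 < (Q ^ k) i j → j ∈ S := by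
    intro k
    induction k with
    | zero =>
      intro i hi j h
      rcases eq_or_ne i j with rfl | hij
      · exact hi
      · simp [Matrix.one_apply_ne hij] at h
    | succ k ih =>
      intro i hi j h
      rw [pow_succ, Matrix.mul_apply] at h
      obtain ⟨l, -, hl⟩ : ∃ l ∈ Finset.univ, 0 < (Q ^ k) i l * Q l j := by
        by_contra! hle
        exact absurd h (not_lt.mpr (Finset.sum_nonpos hle))
      rcases hQ.zero_one l j with h0 | h1
      · simp [h0] at hl
      · rw [h1, mul_one] at hl
        exact hc l (ih i hi l hl) j h1
  obtain ⟨i, hi⟩ := hS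
  obtain ⟨k, -, hk⟩ := hQ.primitive.exists_pos_pow
  exact Set.eq_univ_of_forall fun j => key k i hi j (hk i j)

/-- A zero row of `Q` would remain zero in every positive power. -/
theorem IsMixingAdjacency.exists_succ (hQ : IsMixingAdjacency Q) (i : Fin q) :
    ∃ j, Q i j = 1 := by
  by_contra! h
  obtain ⟨k, hk0, hk⟩ := hQ.primitive.exists_pos_pow
  obtain ⟨k, rfl⟩ := Nat.exists_eq_succ_of_ne_zero hk0.ne'
  have h0 : ∀ j, Q i j = 0 := fun j => (hQ.zero_one i j).resolve_right (h j)
  have := hk i i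
  simp [pow_succ', Matrix.mul_apply, h0] at this

theorem IsMixingAdjacency.exists_pred (hQ : IsMixingAdjacency Q) (j : Fin q) :
    ∃ i, Q i j = 1 := by
  by_contra! h
  obtain ⟨k, hk0, hk⟩ := hQ.primitive.exists_pos_pow
  obtain ⟨k, rfl⟩ := Nat.exists_eq_succ_of_ne_zero hk0.ne'
  have h0 : ∀ i, Q i j = 0 := fun i => (hQ.zero_one i j).resolve_right (h i)
  have := hk j j
  simp [pow_succ, Matrix.mul_apply, h0] at this

theorem exists_split_eq (x : LeftSided Q) (y : RightSided Q) (h : x.1 0 = y.1 0) :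
    ∃ z : TwoSided Q, split z = (x, y) := by
  refine ⟨⟨fun i => if 0 ≤ i then y.1 i.toNat else x.1 (-i).toNat, fun i => ?_⟩, ?_⟩
  -- The case `i = -1` is the seam: the transition into the shared zeroth symbol, the only one that
  -- needs `h`.
  · rcases lt_trichotomy i (-1) with hi | rfl | hi
    · obtain ⟨n, rfl⟩ : ∃ n : ℕ, i = -(n + 2 : ℤ) := ⟨(-i - 2).toNat, by omega⟩
      have e1 : (- -(n + 2 : ℤ)).toNat = n + 2 := by omega
      have e2 : (-(-(n + 2 : ℤ) + 1)).toNat = n + 1 := by omega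
      have h1 : ¬ (0 : ℤ) ≤ -(n + 2 : ℤ) := by omega
      have h2 : ¬ (0 : ℤ) ≤ -(n + 2 : ℤ) + 1 := by omega
      simpa only [h1, h2, e1, e2, if_false] using x.2 (n + 1)
    · simpa [← h] using x.2 0
    · obtain ⟨n, rfl⟩ : ∃ n : ℕ, i = n := ⟨i.toNat, by omega⟩
      have e2 : ((n : ℤ) + 1).toNat = n + 1 := by omega
      have h1 : (0 : ℤ) ≤ n := by omega
      have h2 : (0 : ℤ) ≤ (n : ℤ) + 1 := by omega
      simpa only [h1, h2, e2, if_true, Int.toNat_natCast] using y.2 n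
  · refine Prod.ext (Subtype.ext (funext fun n => ?_)) (Subtype.ext (funext fun n => ?_))
    · change (if 0 ≤ -(n : ℤ) then y.1 (-(n : ℤ)).toNat else x.1 (- -(n : ℤ)).toNat) = _
      rcases n with _ | n
      · simpa using h.symm
      · rw [if_neg (by omega)]
        congr 1
    · change (if 0 ≤ (n : ℤ) then y.1 (n : ℤ).toNat else x.1 (-(n : ℤ)).toNat) = _
      simp

theorem exists_rightSided (hQ : IsMixingAdjacency Q) (i : Fin q) :
    ∃ y : RightSided Q, y.1 0 = i := by
  choose f hf using hQ.exists_succ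
  exact ⟨⟨fun n => f^[n] i, fun n => by
    simpa only [Function.iterate_succ_apply'] using hf _⟩, rfl⟩

theorem exists_leftSided (hQ : IsMixingAdjacency Q) (i : Fin q) :
    ∃ x : LeftSided Q, x.1 0 = i := by
  choose f hf using hQ.exists_pred
  exact ⟨⟨fun n => f^[n] i, fun n => by
    simpa only [Function.iterate_succ_apply'] using hf _⟩, rfl⟩

/-- The left-sided sequence `x` followed by the symbol `j`. -/
def append (x : LeftSided Q) (j : Fin q) (h : Q (x.1 0) j = 1) : LeftSided Q :=
  ⟨fun n => Nat.casesOn n j x.1, fun n => by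
    rcases n with _ | n
    · exact h
    · exact x.2 n⟩

theorem exists_twoSided (hQ : IsMixingAdjacency Q) (i j : Fin q) (h : Q i j = 1) :
    ∃ z : TwoSided Q, z.1 0 = i ∧ z.1 1 = j := by
  obtain ⟨x, rfl⟩ := exists_leftSided hQ i
  obtain ⟨y, rfl⟩ := exists_rightSided hQ j
  let y' : RightSided Q := ⟨fun n => Nat.casesOn n (x.1 0) y.1, fun n => by
    rcases n with _ | n
    · exact h
    · exact y.2 n⟩
  obtain ⟨z, hz⟩ := exists_split_eq x y' rfl
  have hr : projRight z = y' := congrArg Prod.snd hz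
  exact ⟨z, congrFun (congrArg Subtype.val hr) 0, congrFun (congrArg Subtype.val hr) 1⟩

theorem projLeft_surjective (hQ : IsMixingAdjacency Q) :
    Function.Surjective (projLeft (Q := Q)) := by
  intro x
  obtain ⟨y, hy⟩ := exists_rightSided hQ (x.1 0)
  obtain ⟨z, hz⟩ := exists_split_eq x y hy.symm
  exact ⟨z, congrArg Prod.fst hz⟩

theorem continuous_projLeft : Continuous (projLeft (Q := Q)) := by
  unfold projLeft
  refine Continuous.subtype_mk (continuous_pi fun n => ?_) _
  exact (continuous_apply _).comp continuous_subtype_val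

theorem continuous_projRight : Continuous (projRight (Q := Q)) := by
  unfold projRight
  refine Continuous.subtype_mk (continuous_pi fun n => ?_) _
  exact (continuous_apply _).comp continuous_subtype_val

theorem continuous_coord (i : ℤ) : Continuous fun x : TwoSided Q => x.1 i :=
  (continuous_apply i).comp continuous_subtype_val

theorem continuous_coord_left (i : ℕ) : Continuous fun x : LeftSided Q => x.1 i :=
  (continuous_apply i).comp continuous_subtype_val

theorem continuous_coord_right (i : ℕ) : Continuous fun x : RightSided Q => x.1 i :=
  (continuous_apply i).comp continuous_subtype_val

instance compactSpace_twoSided : CompactSpace (TwoSided Q) := by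
  suffices h : IsClosed {x : ℤ → Fin q | ∀ i, Q (x i) (x (i + 1)) = 1} from
    isCompact_iff_compactSpace.mp h.isCompact
  have : {x : ℤ → Fin q | ∀ i, Q (x i) (x (i + 1)) = 1} =
      ⋂ i, (fun x : ℤ → Fin q => (x i, x (i + 1))) ⁻¹' {p | Q p.1 p.2 = 1} := by
    ext x
    simp
  rw [this]
  exact isClosed_iInter fun i => (isClosed_discrete _).preimage
    ((continuous_apply i).prodMk (continuous_apply (i + 1)))

/-- Left-sided sequences that agree with `x` in the positions `-n, …, 0`. -/
def leftCylinder (n : ℕ) (x : LeftSided Q) : Set (LeftSided Q) := {z | ∀ i ≤ n, z.1 i = x.1 i}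

theorem mem_leftCylinder_self (n : ℕ) (x : LeftSided Q) : x ∈ leftCylinder n x := fun _ _ => rfl

theorem mem_leftCylinder_symm {n : ℕ} {x z : LeftSided Q} (h : z ∈ leftCylinder n x) :
    x ∈ leftCylinder n z := fun i hi => (h i hi).symm

theorem isOpen_leftCylinder (n : ℕ) (x : LeftSided Q) : IsOpen (leftCylinder n x) := by
  have : leftCylinder n x = ⋂ i ∈ Set.Iic n, (fun z : LeftSided Q => z.1 i) ⁻¹' {x.1 i} := by
    ext z
    simp [leftCylinder]
  rw [this]
  exact (Set.finite_Iic n).isOpen_biInter fun i _ =>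
    (isOpen_discrete _).preimage (continuous_coord_left i)

/-! ### Hölder continuity as a modulus on cylinders -/

theorem shiftDist_le (x y : TwoSided Q) (n : ℕ) (h : ∀ i : ℤ, i.natAbs ≤ n → x.1 i = y.1 i) :
    shiftDist x y ≤ (2 : ℝ) ^ (-(n : ℤ)) := by
  unfold shiftDist
  split_ifs with hxy
  · positivity
  · refine zpow_le_zpow_right₀ one_le_two ?_
    have hne : {n : ℕ | ∃ j : ℤ, j.natAbs = n ∧ x.1 j ≠ y.1 j}.Nonempty := by
      by_contra hemp
      rw [Set.not_nonempty_iff_eq_empty] at hemp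
      refine hxy (Subtype.ext (funext fun i => ?_))
      by_contra hi
      exact Set.notMem_empty i.natAbs (hemp ▸ ⟨i, rfl, hi⟩)
    obtain ⟨j, hj, hj'⟩ := Nat.sInf_mem hne
    have : n < j.natAbs := by
      by_contra hle
      exact hj' (h j (not_lt.mp hle))
    rw [← hj]
    omega

theorem shiftDist_nonneg (x y : TwoSided Q) : 0 ≤ shiftDist x y := by
  unfold shiftDist
  split_ifs <;> positivity

/-- The only form in which Hölder continuity enters. The one-sided inequality suffices, since
agreement of coordinates is symmetric. -/
theorem IsHolder.exists_modulus {ψ : TwoSided Q → ℝ} (h : IsHolder ψ) :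
    ∃ ε : ℕ → ℝ, (∀ n, 0 ≤ ε n) ∧ Tendsto ε atTop (𝓝 0) ∧
      ∀ n x y, (∀ i : ℤ, i.natAbs ≤ n → x.1 i = y.1 i) → ψ x ≤ ψ y + ε n := by
  obtain ⟨C, α, hα, hψ⟩ := h
  -- The Hölder constant is not assumed nonnegative, hence `|C|`.
  refine ⟨fun n => |C| * ((2 : ℝ) ^ (-(n : ℤ))) ^ α, fun n => by positivity, ?_, ?_⟩
  · have h1 : Tendsto (fun n : ℕ => (2 : ℝ) ^ (-(n : ℤ))) atTop (𝓝 0) := by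
      simpa using tendsto_pow_atTop_nhds_zero_of_lt_one (r := (2 : ℝ)⁻¹) (by norm_num) (by norm_num)
    have h2 := (h1.rpow_const (p := α) (Or.inr hα.le)).const_mul |C|
    simpa [Real.zero_rpow hα.ne'] using h2
  · intro n x y hxy
    have h1 := (le_abs_self _).trans (hψ x y)
    have h2 : C * shiftDist x y ^ α ≤ |C| * ((2 : ℝ) ^ (-(n : ℤ))) ^ α := by
      refine mul_le_mul (le_abs_self C) ?_ ?_ (abs_nonneg C)
      · exact Real.rpow_le_rpow (shiftDist_nonneg x y) (shiftDist_le x y n hxy) hα.le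
      · exact Real.rpow_nonneg (shiftDist_nonneg x y) α
    linarith

/-! ### The disintegration over the left-sided shift -/

theorem measurableSet_matching :
    MeasurableSet {p : LeftSided Q × RightSided Q | p.1.1 0 = p.2.1 0} :=
  measurableSet_eq_fun ((continuous_coord_left 0).measurable.comp measurable_fst)
    ((continuous_coord_right 0).measurable.comp measurable_snd)

theorem measurableSet_cylinder (ξ : Fin q) : MeasurableSet (cylinder Q ξ) :=
  (continuous_coord 0).measurable (measurableSet_singleton ξ)

/-- `μ` has density `ψ` with respect to the product of its projections. -/
def HasProductDensity (μ : Measure (TwoSided Q)) (ψ : TwoSided Q → ℝ) : Prop :=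
  ∀ ξ : Fin q, μ.restrict (cylinder Q ξ) =
      ((((μ.map projLeft).prod (μ.map projRight)).comap split).restrict
        (cylinder Q ξ)).withDensity fun x => ENNReal.ofReal (ψ x)

theorem HasProductDensity.eq_withDensity {μ : Measure (TwoSided Q)} {ψ : TwoSided Q → ℝ}
    (h : HasProductDensity μ ψ) :
    μ = (((μ.map projLeft).prod (μ.map projRight)).comap split).withDensity
      fun x => ENNReal.ofReal (ψ x) := by
  refine Measure.ext_of_iUnion_eq_univ (s := cylinder Q) ?_ fun ξ => ?_
  · exact Set.eq_univ_of_forall fun z => Set.mem_iUnion.mpr ⟨z.1 0, rfl⟩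
  · rw [restrict_withDensity (measurableSet_cylinder ξ)]
    exact h ξ

theorem isOpenPosMeasure_map_projLeft (hQ : IsMixingAdjacency Q) {μ : Measure (TwoSided Q)}
    [μ.IsOpenPosMeasure] :
    (μ.map projLeft).IsOpenPosMeasure :=
  continuous_projLeft.isOpenPosMeasure_map (projLeft_surjective hQ)

section Disintegration

variable [Nonempty (TwoSided Q)]

/-- On pairs with different zeroth symbols the values are arbitrary; `density` vanishes there. -/
theorem exists_measurable_glue :
    ∃ g : LeftSided Q × RightSided Q → TwoSided Q, Measurable g ∧ g ∘ split = id :=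
  measurableEmbedding_split.exists_measurable_extend measurable_id fun _ => inferInstance

/-- A measurable left inverse of `split`. -/
def glue : LeftSided Q × RightSided Q → TwoSided Q := exists_measurable_glue.choose

theorem measurable_glue : Measurable (glue (Q := Q)) := exists_measurable_glue.choose_spec.1

theorem glue_split (z : TwoSided Q) : glue (split z) = z :=
  congrFun exists_measurable_glue.choose_spec.2 z

theorem split_glue {p : LeftSided Q × RightSided Q} (h : p.1.1 0 = p.2.1 0) :
    split (glue p) = p := by
  obtain ⟨z, hz⟩ := exists_split_eq p.1 p.2 h
  rw [← show split z = p from hz, glue_split]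

theorem glue_apply_nonneg {x : LeftSided Q} {y : RightSided Q} (h : x.1 0 = y.1 0) (n : ℕ) :
    (glue (x, y)).1 n = y.1 n :=
  congrFun (congrArg Subtype.val (congrArg Prod.snd (split_glue (p := (x, y)) h))) n

theorem glue_apply_nonpos {x : LeftSided Q} {y : RightSided Q} (h : x.1 0 = y.1 0) (n : ℕ) :
    (glue (x, y)).1 (-(n : ℤ)) = x.1 n :=
  congrFun (congrArg Subtype.val (congrArg Prod.fst (split_glue (p := (x, y)) h))) n

/-- The density of the two-sided measure with respect to the product of its projections. -/
def density (ψ : TwoSided Q → ℝ) (x : LeftSided Q) (y : RightSided Q) : ENNReal :=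
  if x.1 0 = y.1 0 then ENNReal.ofReal (ψ (glue (x, y))) else 0

theorem measurable_density {ψ : TwoSided Q → ℝ} (hψ : Measurable ψ) :
    Measurable (Function.uncurry (density ψ)) :=
  Measurable.ite measurableSet_matching (hψ.comp measurable_glue).ennreal_ofReal measurable_const

variable {μ : Measure (TwoSided Q)} [IsProbabilityMeasure μ] {ψ : TwoSided Q → ℝ}

instance isProbabilityMeasure_map_projLeft : IsProbabilityMeasure (μ.map projLeft) :=
  Measure.isProbabilityMeasure_map continuous_projLeft.measurable.aemeasurable

instance isProbabilityMeasure_map_projRight : IsProbabilityMeasure (μ.map projRight) :=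
  Measure.isProbabilityMeasure_map continuous_projRight.measurable.aemeasurable

/-- Transport along `split`, then Tonelli. The range of `split` is the set of matching pairs, off
which `density` is zero, so the restriction to it can be dropped. -/
theorem HasProductDensity.lintegral_eq (h : HasProductDensity μ ψ) (hψ : Measurable ψ)
    {F : TwoSided Q → ENNReal} (hF : Measurable F) :
    ∫⁻ z, F z ∂μ = ∫⁻ x, ∫⁻ y, density ψ x y * F (glue (x, y)) ∂(μ.map projRight)
      ∂(μ.map projLeft) := by
  set ρ := (μ.map projLeft).prod (μ.map projRight) with hρ
  have hG : Measurable fun p : LeftSided Q × RightSided Q => density ψ p.1 p.2 * F (glue p) :=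
    (measurable_density hψ).mul (hF.comp measurable_glue)
  have hr : Set.range (split (Q := Q)) = {p | p.1.1 0 = p.2.1 0} := by
    ext p
    refine ⟨?_, fun hp => ⟨glue p, split_glue hp⟩⟩
    rintro ⟨z, rfl⟩
    rfl
  calc ∫⁻ z, F z ∂μ
      = ∫⁻ z, ENNReal.ofReal (ψ z) * F z ∂(ρ.comap split) := by
        conv_lhs => rw [h.eq_withDensity]
        rw [lintegral_withDensity_eq_lintegral_mul _ hψ.ennreal_ofReal hF]
        rfl
    _ = ∫⁻ z, density ψ (split z).1 (split z).2 * F (glue (split z)) ∂(ρ.comap split) := by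
        refine lintegral_congr fun z => ?_
        have h0 : (split z).1.1 0 = (split z).2.1 0 := rfl
        rw [density, if_pos h0, glue_split]
    _ = ∫⁻ p, density ψ p.1 p.2 * F (glue p) ∂((ρ.comap split).map split) :=
        (lintegral_map hG measurableEmbedding_split.measurable).symm
    _ = ∫⁻ p in {p | p.1.1 0 = p.2.1 0}, density ψ p.1 p.2 * F (glue p) ∂ρ := by
        rw [measurableEmbedding_split.map_comap, hr]
    _ = ∫⁻ p, density ψ p.1 p.2 * F (glue p) ∂ρ := by
        refine setLIntegral_eq_of_support_subset fun p hp => ?_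
        by_contra hne
        exact hp (by simp [density, show p.1.1 0 ≠ p.2.1 0 from hne])
    _ = _ := lintegral_prod _ hG.aemeasurable

variable (μ ψ) in
/-- The conditional measures over the left-sided shift obtained by averaging the conditional
measures of an s-state over the local unstable sets. -/
def pastKernel (κ : Kernel (TwoSided Q) (RP d)) : Kernel (LeftSided Q) (RP d) :=
  Kernel.snd ((Kernel.withDensity (Kernel.const _ (μ.map projRight)) (density ψ)) ⊗ₖ
    κ.comap glue measurable_glue)

theorem density_ne_top (x : LeftSided Q) (y : RightSided Q) : density ψ x y ≠ ⊤ := by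
  unfold density
  split_ifs <;> simp

theorem lintegral_pastKernel (hψ : Measurable ψ) (κ : Kernel (TwoSided Q) (RP d))
    [IsMarkovKernel κ] (x : LeftSided Q) {f : RP d → ENNReal} (hf : Measurable f) :
    ∫⁻ v, f v ∂(pastKernel μ ψ κ x) =
      ∫⁻ y, density ψ x y * ∫⁻ v, f v ∂(κ (glue (x, y))) ∂(μ.map projRight) := by
  have : IsSFiniteKernel
      (Kernel.withDensity (Kernel.const (LeftSided Q) (μ.map projRight)) (density ψ)) :=
    Kernel.IsSFiniteKernel.withDensity _ density_ne_top
  have h1 := Kernel.lintegral_compProd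
    (Kernel.withDensity (Kernel.const (LeftSided Q) (μ.map projRight)) (density ψ))
    (κ.comap glue measurable_glue) x (hf.comp measurable_snd)
  rw [pastKernel, Kernel.lintegral_snd _ _ hf]
  refine h1.trans ?_
  rw [Kernel.lintegral_withDensity _ (measurable_density hψ) _ ?_]
  · rfl
  · exact (hf.lintegral_kernel (κ := κ.comap glue measurable_glue)).comp measurable_prodMk_left

/-- Nearby points of the left-sided shift have densities that differ by at most `ε n`. -/
theorem density_le_add {ε : ℕ → ℝ}
    (hε : ∀ n x y, (∀ i : ℤ, i.natAbs ≤ n → x.1 i = y.1 i) → ψ x ≤ ψ y + ε n)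
    {n : ℕ} {x z : LeftSided Q} (hxz : z ∈ leftCylinder n x) (y : RightSided Q) :
    density ψ x y ≤ density ψ z y + ENNReal.ofReal (ε n) := by
  have h0 : z.1 0 = x.1 0 := hxz 0 (Nat.zero_le n)
  unfold density
  rw [h0]
  split_ifs with h
  · refine (ENNReal.ofReal_le_ofReal (hε n _ _ fun i hi => ?_)).trans ENNReal.ofReal_add_le
    obtain ⟨k, rfl | rfl⟩ := i.eq_nat_or_neg
    · rw [glue_apply_nonneg h, glue_apply_nonneg (h0.trans h)]
    · rw [glue_apply_nonpos h, glue_apply_nonpos (h0.trans h)]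
      exact (hxz k (by simpa using hi)).symm
  · exact zero_le

/-- The kernel does not depend on the past. -/
def IsStableKernel (κ : Kernel (TwoSided Q) (RP d)) : Prop :=
  ∀ x y, SameStable x y → κ y = κ x

theorem IsStableKernel.glue_eq {κ : Kernel (TwoSided Q) (RP d)} (hκ : IsStableKernel κ)
    {x z : LeftSided Q} {y : RightSided Q} (hx : x.1 0 = y.1 0) (hz : z.1 0 = y.1 0) :
    κ (glue (x, y)) = κ (glue (z, y)) := by
  refine hκ _ _ fun i hi => ?_
  lift i to ℕ using hi
  rw [glue_apply_nonneg hx, glue_apply_nonneg hz]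

/-- For a fixed future the fibre measures over `x` and `z` coincide, so only the density changes, by
at most `ε n`. The bound is uniform in `f`: this is continuity in total variation, and it applies to
indicators of subspaces as well as to continuous functions. -/
theorem lintegral_pastKernel_le_add (hψ : Measurable ψ) {κ : Kernel (TwoSided Q) (RP d)}
    [IsMarkovKernel κ] (hκ : IsStableKernel κ) {ε : ℕ → ℝ}
    (hε : ∀ n x y, (∀ i : ℤ, i.natAbs ≤ n → x.1 i = y.1 i) → ψ x ≤ ψ y + ε n)
    {n : ℕ} {x z : LeftSided Q} (hxz : z ∈ leftCylinder n x) {f : RP d → ENNReal}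
    (hf : Measurable f) (hf1 : ∀ v, f v ≤ 1) :
    ∫⁻ v, f v ∂(pastKernel μ ψ κ x) ≤
      ∫⁻ v, f v ∂(pastKernel μ ψ κ z) + ENNReal.ofReal (ε n) := by
  rw [lintegral_pastKernel hψ κ x hf, lintegral_pastKernel hψ κ z hf]
  have h0 : z.1 0 = x.1 0 := hxz 0 (Nat.zero_le n)
  have h1 : ∀ y, ∫⁻ v, f v ∂(κ (glue (x, y))) ≤ 1 := fun y =>
    (lintegral_mono hf1).trans (by simp)
  calc _ ≤ ∫⁻ y, (density ψ z y * ∫⁻ v, f v ∂(κ (glue (z, y))) + ENNReal.ofReal (ε n))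
        ∂(μ.map projRight) := by
        refine lintegral_mono fun y => ?_
        by_cases h : x.1 0 = y.1 0
        · rw [← hκ.glue_eq h (h0.trans h)]
          calc _ ≤ (density ψ z y + ENNReal.ofReal (ε n)) *
                ∫⁻ v, f v ∂(κ (glue (x, y))) := by
                gcongr
                exact density_le_add hε hxz y
            _ ≤ _ := by
                rw [add_mul]
                gcongr
                exact mul_le_of_le_one_right (zero_le) (h1 y)
        · simp [density, h]
    _ = _ := by
        rw [lintegral_add_right _ measurable_const]
        simp

theorem pastKernel_apply_le_add (hψ : Measurable ψ) {κ : Kernel (TwoSided Q) (RP d)}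
    [IsMarkovKernel κ] (hκ : IsStableKernel κ) {ε : ℕ → ℝ}
    (hε : ∀ n x y, (∀ i : ℤ, i.natAbs ≤ n → x.1 i = y.1 i) → ψ x ≤ ψ y + ε n)
    {n : ℕ} {x z : LeftSided Q} (hxz : z ∈ leftCylinder n x) {s : Set (RP d)}
    (hs : MeasurableSet s) :
    pastKernel μ ψ κ x s ≤ pastKernel μ ψ κ z s + ENNReal.ofReal (ε n) := by
  have := lintegral_pastKernel_le_add (μ := μ) hψ hκ hε hxz (f := s.indicator 1)
    (measurable_one.indicator hs) (fun v => Set.indicator_le_self' (fun _ _ => zero_le) v)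
  simpa only [lintegral_indicator_one hs] using this

/-- The measure projected to the left-sided shift is obtained from `pastKernel`. -/
theorem projectMeasure_apply (h : HasProductDensity μ ψ) (hψ : Measurable ψ)
    {κ : Kernel (TwoSided Q) (RP d)} [IsMarkovKernel κ] {s : Set (LeftSided Q × RP d)}
    (hs : MeasurableSet s) :
    projectMeasure (μ.compProd κ) s =
      ∫⁻ x, pastKernel μ ψ κ x (Prod.mk x ⁻¹' s) ∂(μ.map projLeft) := by
  have hm : Measurable fun p : TwoSided Q × RP d => (projLeft p.1, p.2) :=
    (continuous_projLeft.measurable.comp measurable_fst).prodMk measurable_snd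
  have hs' := hm hs
  rw [projectMeasure, Measure.map_apply hm hs, Measure.compProd_apply hs',
    h.lintegral_eq hψ (Kernel.measurable_kernel_prodMk_left hs')]
  refine lintegral_congr fun x => ?_
  have hsx : MeasurableSet (Prod.mk x ⁻¹' s) := measurable_prodMk_left hs
  have := lintegral_pastKernel (μ := μ) hψ κ x (measurable_one.indicator hsx)
  rw [lintegral_indicator_one hsx] at this
  rw [this]
  refine lintegral_congr fun y => ?_
  rw [lintegral_indicator_one hsx]
  by_cases hxy : x.1 0 = y.1 0
  · congr 2
    ext v
    change (projLeft (glue (x, y)), v) ∈ s ↔ (x, v) ∈ s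
    rw [show projLeft (glue (x, y)) = x from
      congrArg Prod.fst (split_glue (p := (x, y)) hxy)]
  · simp [density, hxy]

/-- The mass is one almost everywhere because the first marginal is `μ`; full support and the
modulus extend this to every past. -/
theorem pastKernel_univ (hQ : IsMixingAdjacency Q) [μ.IsOpenPosMeasure]
    (h : HasProductDensity μ ψ) (hψ : Measurable ψ) {κ : Kernel (TwoSided Q) (RP d)}
    [IsMarkovKernel κ] (hκ : IsStableKernel κ) {ε : ℕ → ℝ} (hε0 : Tendsto ε atTop (𝓝 0))
    (hε : ∀ n x y, (∀ i : ℤ, i.natAbs ≤ n → x.1 i = y.1 i) → ψ x ≤ ψ y + ε n)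
    (x : LeftSided Q) : pastKernel μ ψ κ x Set.univ = 1 := by
  have := isOpenPosMeasure_map_projLeft (μ := μ) hQ
  have hae : ∀ᵐ z ∂(μ.map projLeft), pastKernel μ ψ κ z Set.univ = 1 := by
    refine ae_eq_of_forall_setLIntegral_eq_of_sigmaFinite
      ((pastKernel μ ψ κ).measurable_coe .univ) measurable_const fun S hS _ => ?_
    have h1 := projectMeasure_apply (κ := κ) h hψ (hS.prod .univ)
    have hm : Measurable fun p : TwoSided Q × RP d => (projLeft p.1, p.2) :=
      (continuous_projLeft.measurable.comp measurable_fst).prodMk measurable_snd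
    have h2 : projectMeasure (μ.compProd κ) (S ×ˢ Set.univ) = μ.map projLeft S := by
      have h3 : (μ.compProd κ).fst (projLeft ⁻¹' S) = μ (projLeft ⁻¹' S) := by
        rw [Measure.fst_compProd]
      rw [projectMeasure, Measure.map_apply hm (hS.prod .univ),
        Measure.map_apply continuous_projLeft.measurable hS, ← h3,
        Measure.fst_apply (continuous_projLeft.measurable hS)]
      congr 1
      ext p
      exact and_iff_left trivial
    rw [h2] at h1
    rw [setLIntegral_const, one_mul, h1, ← lintegral_indicator hS]
    refine lintegral_congr fun z => ?_
    by_cases hz : z ∈ S <;> simp [hz]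
  have key : ∀ n, ∃ z ∈ leftCylinder n x, pastKernel μ ψ κ z Set.univ = 1 := by
    intro n
    have hpos : μ.map projLeft (leftCylinder n x) ≠ 0 :=
      ((isOpen_leftCylinder n x).measure_pos _ ⟨x, mem_leftCylinder_self n x⟩).ne'
    obtain ⟨z, hz, hz'⟩ := (frequently_ae_mem_iff.mpr hpos).and_eventually hae |>.exists
    exact ⟨z, hz, hz'⟩
  have hlim : Tendsto (fun n => 1 + ENNReal.ofReal (ε n)) atTop (𝓝 1) := by
    simpa using (ENNReal.tendsto_ofReal hε0).const_add 1
  refine le_antisymm (ge_of_tendsto' hlim fun n => ?_) ?_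
  · obtain ⟨z, hz, hz1⟩ := key n
    rw [← hz1]
    exact pastKernel_apply_le_add hψ hκ hε hz .univ
  · have hlim' : Tendsto (fun n => pastKernel μ ψ κ x Set.univ + ENNReal.ofReal (ε n)) atTop
        (𝓝 (pastKernel μ ψ κ x Set.univ)) := by
      simpa using (ENNReal.tendsto_ofReal hε0).const_add (pastKernel μ ψ κ x Set.univ)
    refine ge_of_tendsto' hlim' fun n => ?_
    obtain ⟨z, hz, hz1⟩ := key n
    rw [← hz1]
    exact pastKernel_apply_le_add hψ hκ hε (mem_leftCylinder_symm hz) .univ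

end Disintegration

/-! ### Self-similarity of the disintegration -/

/-- The value of a two-step cocycle on sequences with `x 0 = i` and `x 1 = j`. -/
def transition (A : TwoSided Q → Matrix.GeneralLinearGroup (Fin d) ℝ) (i j : Fin q) :
    Matrix.GeneralLinearGroup (Fin d) ℝ :=
  open Classical in
  if h : ∃ x : TwoSided Q, x.1 0 = i ∧ x.1 1 = j then A h.choose else 1

theorem IsTwoStep.eq_transition {A : TwoSided Q → Matrix.GeneralLinearGroup (Fin d) ℝ}
    (hA : IsTwoStep A) (x : TwoSided Q) : A x = transition A (x.1 0) (x.1 1) := by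
  have h : ∃ y : TwoSided Q, y.1 0 = x.1 0 ∧ y.1 1 = x.1 1 := ⟨x, rfl, rfl⟩
  rw [transition, dif_pos h]
  exact hA _ _ h.choose_spec.1.symm h.choose_spec.2.symm

theorem map_mem_projectivization_map_iff (g : Matrix.GeneralLinearGroup (Fin d) ℝ)
    (W : Submodule ℝ (E d)) (p : RP d) :
    Projectivization.map (act g) (act_injective g) p ∈ (W.map (act g)).projectivization ↔
      p ∈ W.projectivization := by
  induction p using Projectivization.ind with
  | h v hv =>
    rw [Projectivization.map_mk, Submodule.mk_mem_projectivization_iff,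
      Submodule.mk_mem_projectivization_iff, Submodule.mem_map]
    exact ⟨fun ⟨w, hw, h⟩ => act_injective g h ▸ hw, fun h => ⟨v, h, rfl⟩⟩

/-- The shift moves the past back one place and makes the symbol in position 1 the newest one. -/
theorem projLeft_shift_mem_iff (n : ℕ) (x : LeftSided Q) (j : Fin q) (h : Q (x.1 0) j = 1)
    (z : TwoSided Q) : projLeft (shift z) ∈ leftCylinder (n + 1) (append x j h) ↔
      projLeft z ∈ leftCylinder n x ∧ z.1 1 = j := by
  have e : ∀ i : ℕ, (projLeft (shift z)).1 (i + 1) = (projLeft z).1 i := fun i => by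
    have e : -((i + 1 : ℕ) : ℤ) + 1 = -(i : ℤ) := by
      push_cast
      ring
    exact congrArg z.1 e
  have e0 : (projLeft (shift z)).1 0 = z.1 1 := rfl
  constructor
  · intro hz
    refine ⟨fun i hi => ?_, ?_⟩
    · rw [← e i, hz (i + 1) (by omega)]
      rfl
    · rw [← e0, hz 0 (by omega)]
      rfl
  · rintro ⟨hz, h1⟩ i hi
    rcases i with _ | i
    · exact e0.trans h1
    · rw [e i, hz i (by omega)]
      rfl

/-- The symbols that may follow `i`. -/
abbrev Successor (Q : Matrix (Fin q) (Fin q) ℤ) (i : Fin q) : Type := {j : Fin q // Q i j = 1}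

theorem measurableSet_leftCylinder (n : ℕ) (x : LeftSided Q) :
    MeasurableSet (leftCylinder n x) := (isOpen_leftCylinder n x).measurableSet

/-- Splitting by the symbol in position 1, each piece is a preimage under the skew product, because
the two-step cocycle is constant on it. -/
theorem projectMeasure_leftCylinder_prod {μ : Measure (TwoSided Q)}
    {A : TwoSided Q → Matrix.GeneralLinearGroup (Fin d) ℝ} (hA : IsTwoStep A)
    {m : Measure (TwoSided Q × RP d)} (hm : IsInvariantSState μ A m) (n : ℕ) (x : LeftSided Q)
    (W : Submodule ℝ (E d)) :
    projectMeasure m (leftCylinder n x ×ˢ (W.projectivization : Set (RP d))) =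
      ∑ j : Successor Q (x.1 0), projectMeasure m (leftCylinder (n + 1) (append x j.1 j.2) ×ˢ
        ((W.map (act (transition A (x.1 0) j.1))).projectivization : Set (RP d))) := by
  have := hm.isProbability
  have hp : Measurable fun p : TwoSided Q × RP d => (projLeft p.1, p.2) :=
    (continuous_projLeft.measurable.comp measurable_fst).prodMk measurable_snd
  -- Otherwise the pushforward would be zero by convention, whereas it equals the probability
  -- measure `m`.
  have hsk : AEMeasurable (skewProduct A) m := by
    refine AEMeasurable.of_map_ne_zero ?_
    rw [hm.invariant]
    exact IsProbabilityMeasure.ne_zero m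
  have hms : ∀ k y (W' : Submodule ℝ (E d)), MeasurableSet
      (leftCylinder k y ×ˢ (W'.projectivization : Set (RP d)) : Set (LeftSided Q × RP d)) :=
    fun k y W' => (measurableSet_leftCylinder k y).prod (measurableSet_projectivization W')
  set S := (fun p : TwoSided Q × RP d => (projLeft p.1, p.2)) ⁻¹'
    (leftCylinder n x ×ˢ (W.projectivization : Set (RP d))) with hS
  have hSm : MeasurableSet S := hp (hms _ _ _)
  have hcoord : ∀ j : Fin q, MeasurableSet {p : TwoSided Q × RP d | p.1.1 1 = j} := fun j =>
    ((continuous_coord 1).measurable.comp measurable_fst) (measurableSet_singleton j)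
  have hU : S = ⋃ j : Successor Q (x.1 0), S ∩ {p | p.1.1 1 = j.1} := by
    ext p
    refine ⟨fun h => ?_, fun h => ?_⟩
    · have h0 : p.1.1 0 = x.1 0 := h.1 0 (Nat.zero_le n)
      exact Set.mem_iUnion.mpr ⟨⟨p.1.1 1, by rw [← h0]; exact p.1.2 0⟩, h, rfl⟩
    · obtain ⟨j, hj⟩ := Set.mem_iUnion.mp h
      exact hj.1
  rw [projectMeasure, Measure.map_apply hp (hms _ _ _), ← hS, hU, measure_iUnion, tsum_fintype]
  · refine Finset.sum_congr rfl fun j _ => ?_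
    rw [Measure.map_apply hp (hms _ _ _)]
    conv_rhs => rw [← hm.invariant]
    rw [Measure.map_apply_of_aemeasurable hsk (hp (hms _ _ _))]
    congr 1
    ext ⟨z, v⟩
    change ((projLeft z ∈ leftCylinder n x ∧ v ∈ W.projectivization) ∧ z.1 1 = j.1) ↔
      (projLeft (shift z) ∈ leftCylinder (n + 1) (append x j.1 j.2) ∧
        Projectivization.map (act (A z)) (act_injective (A z)) v ∈
          (W.map (act (transition A (x.1 0) j.1))).projectivization)
    rw [projLeft_shift_mem_iff]
    have key : projLeft z ∈ leftCylinder n x → z.1 1 = j.1 →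
        transition A (x.1 0) j.1 = A z := fun h1 h2 => by
      have h0 : z.1 0 = x.1 0 := h1 0 (Nat.zero_le n)
      rw [hA.eq_transition z, h2, h0]
    constructor
    · rintro ⟨⟨h1, h2⟩, h3⟩
      rw [key h1 h3, map_mem_projectivization_map_iff]
      exact ⟨⟨h1, h3⟩, h2⟩
    · rintro ⟨⟨h1, h3⟩, h2⟩
      rw [key h1 h3, map_mem_projectivization_map_iff] at h2
      exact ⟨⟨h1, h2⟩, h3⟩
  · intro i j hij
    refine Set.disjoint_left.mpr fun p hi hj => hij (Subtype.ext ?_)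
    exact hi.2.symm.trans hj.2
  · exact fun j => hSm.inter (hcoord j.1)

/-- Given the past, the next symbol is `j` with probability at least the minimum of `ψ` times the
measure of the futures starting with `x.1 0, j`. This bound does not depend on `n`. -/
theorem exists_le_leftCylinder_append [Nonempty (TwoSided Q)] (hQ : IsMixingAdjacency Q)
    {μ : Measure (TwoSided Q)} [IsProbabilityMeasure μ] [μ.IsOpenPosMeasure]
    (hμ : MeasurePreserving shift μ μ) {ψ : TwoSided Q → ℝ} (h : HasProductDensity μ ψ)
    (hψ : Continuous ψ) (hpos : ∀ z, 0 < ψ z) (x : LeftSided Q) (j : Fin q)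
    (hj : Q (x.1 0) j = 1) :
    ∃ c : ℝ, 0 < c ∧ ∀ n, c * (μ.map projLeft).real (leftCylinder n x) ≤
      (μ.map projLeft).real (leftCylinder (n + 1) (append x j hj)) := by
  obtain ⟨z₀, -, hz₀⟩ := isCompact_univ.exists_isMinOn Set.univ_nonempty hψ.continuousOn
  have hmin : ∀ z, ψ z₀ ≤ ψ z := fun z => hz₀ (Set.mem_univ z)
  set Y : Set (RightSided Q) := {y | y.1 0 = x.1 0 ∧ y.1 1 = j} with hY
  have hYo : IsOpen Y :=
    ((isOpen_discrete {x.1 0}).preimage (continuous_coord_right 0)).inter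
      ((isOpen_discrete {j}).preimage (continuous_coord_right 1))
  have hb : 0 < (μ.map projRight).real Y := by
    refine ENNReal.toReal_pos (ne_of_gt ?_) (measure_ne_top _ _)
    rw [Measure.map_apply continuous_projRight.measurable hYo.measurableSet]
    refine (hYo.preimage continuous_projRight).measure_pos _ ?_
    exact exists_twoSided hQ _ _ hj
  refine ⟨ψ z₀ * (μ.map projRight).real Y, mul_pos (hpos z₀) hb, fun n => ?_⟩
  set C := leftCylinder n x with hC
  have hCm : MeasurableSet C := measurableSet_leftCylinder n x
  have hle : ENNReal.ofReal (ψ z₀) * μ.map projRight Y * μ.map projLeft C ≤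
      μ.map projLeft (leftCylinder (n + 1) (append x j hj)) := by
    set S : Set (TwoSided Q) := projLeft ⁻¹' C ∩ {z | z.1 1 = j} with hS
    have hSm : MeasurableSet S := (continuous_projLeft.measurable hCm).inter
      ((continuous_coord 1).measurable (measurableSet_singleton j))
    have h1 : μ.map projLeft (leftCylinder (n + 1) (append x j hj)) = μ S := by
      rw [Measure.map_apply continuous_projLeft.measurable (measurableSet_leftCylinder _ _),
        ← hμ.measure_preimage
          (continuous_projLeft.measurable (measurableSet_leftCylinder _ _)).nullMeasurableSet]
      congr 1
      ext z
      exact projLeft_shift_mem_iff n x j hj z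
    rw [h1, ← lintegral_indicator_one hSm,
      h.lintegral_eq hψ.measurable (measurable_one.indicator hSm), ← setLIntegral_const,
      ← lintegral_indicator hCm]
    refine lintegral_mono fun z => ?_
    by_cases hz : z ∈ C
    · rw [Set.indicator_of_mem hz, ← setLIntegral_const, ← lintegral_indicator hYo.measurableSet]
      refine lintegral_mono fun y => ?_
      by_cases hy : y ∈ Y
      · have hzy : z.1 0 = y.1 0 := (hz 0 (Nat.zero_le n)).trans hy.1.symm
        have hmem : glue (z, y) ∈ S := by
          refine ⟨?_, ?_⟩
          · change projLeft (glue (z, y)) ∈ C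
            rwa [show projLeft (glue (z, y)) = z from
              congrArg Prod.fst (split_glue (p := (z, y)) hzy)]
          · exact (glue_apply_nonneg hzy 1).trans hy.2
        rw [Set.indicator_of_mem hy, Set.indicator_of_mem hmem, density, if_pos hzy,
          Pi.one_apply, mul_one]
        exact ENNReal.ofReal_le_ofReal (hmin _)
      · simp [Set.indicator_of_notMem hy]
    · simp [Set.indicator_of_notMem hz]
  have := ENNReal.toReal_mono (measure_ne_top _ _) hle
  rwa [ENNReal.toReal_mul, ENNReal.toReal_mul, ENNReal.toReal_ofReal (hpos z₀).le] at this

theorem map_act_top (g : Matrix.GeneralLinearGroup (Fin d) ℝ) :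
    (⊤ : Submodule ℝ (E d)).map (act g) = ⊤ := by
  rw [Submodule.map_top, LinearMap.range_eq_top]
  exact LinearMap.injective_iff_surjective.mp (act_injective g)

/-- The modulus integrated over a cylinder: the average of `K z s` differs from `K x s` by at most
`ε n`. -/
theorem abs_compProd_leftCylinder_prod_sub_le {ν : Measure (LeftSided Q)} [IsProbabilityMeasure ν]
    {K : Kernel (LeftSided Q) (RP d)} [IsMarkovKernel K] {ε : ℕ → ℝ} (hε : ∀ n, 0 ≤ ε n)
    {s : Set (RP d)} (hs : MeasurableSet s)
    (hK : ∀ n x, ∀ z ∈ leftCylinder n x, K x s ≤ K z s + ENNReal.ofReal (ε n))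
    (n : ℕ) (x : LeftSided Q) :
    |(ν.compProd K).real (leftCylinder n x ×ˢ s) - (K x).real s * ν.real (leftCylinder n x)| ≤
      ε n * ν.real (leftCylinder n x) := by
  set C := leftCylinder n x with hC
  have hCm : MeasurableSet C := measurableSet_leftCylinder n x
  have h0 : (ν.compProd K) (C ×ˢ s) = ∫⁻ z in C, K z s ∂ν := Measure.compProd_apply_prod hCm hs
  have h1 : (ν.compProd K) (C ×ˢ s) ≤ (K x s + ENNReal.ofReal (ε n)) * ν C := by
    rw [h0, ← setLIntegral_const]
    exact setLIntegral_mono measurable_const fun z hz => hK n z x (mem_leftCylinder_symm hz)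
  have h2 : K x s * ν C ≤ (ν.compProd K) (C ×ˢ s) + ENNReal.ofReal (ε n) * ν C := by
    rw [h0, ← setLIntegral_const, ← setLIntegral_const, ← lintegral_add_right _ measurable_const]
    exact setLIntegral_mono ((K.measurable_coe hs).add measurable_const) fun z hz => hK n x z hz
  have h1' := ENNReal.toReal_mono (by finiteness) h1
  have h2' := ENNReal.toReal_mono (by finiteness) h2
  rw [ENNReal.toReal_mul, ENNReal.toReal_add (by finiteness) (by finiteness),
    ENNReal.toReal_ofReal (hε n)] at h1'
  rw [ENNReal.toReal_add (by finiteness) (by finiteness), ENNReal.toReal_mul, ENNReal.toReal_mul,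
    ENNReal.toReal_ofReal (hε n)] at h2'
  simp only [Measure.real]
  rw [abs_le]
  constructor <;> linarith

/-- The disintegration is approximately self-similar, with weights bounded away from zero. -/
theorem exists_weights {ν : Measure (LeftSided Q)} [IsProbabilityMeasure ν] [ν.IsOpenPosMeasure]
    {K : Kernel (LeftSided Q) (RP d)} [IsMarkovKernel K] {ε : ℕ → ℝ} (hε : ∀ n, 0 ≤ ε n)
    (hε0 : Tendsto ε atTop (𝓝 0))
    (hK : ∀ s : Set (RP d), MeasurableSet s → ∀ n x, ∀ z ∈ leftCylinder n x,
      K x s ≤ K z s + ENNReal.ofReal (ε n))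
    {B : Fin q → Fin q → Matrix.GeneralLinearGroup (Fin d) ℝ}
    (hinv : ∀ n (x : LeftSided Q) (W : Submodule ℝ (E d)),
      (ν.compProd K) (leftCylinder n x ×ˢ (W.projectivization : Set (RP d))) =
      ∑ j : Successor Q (x.1 0), (ν.compProd K) (leftCylinder (n + 1) (append x j.1 j.2) ×ˢ
        ((W.map (act (B (x.1 0) j.1))).projectivization : Set (RP d))))
    {x : LeftSided Q} {c : Successor Q (x.1 0) → ℝ}
    (hc : ∀ j n, c j * ν.real (leftCylinder n x) ≤
      ν.real (leftCylinder (n + 1) (append x j.1 j.2)))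
    (W : Submodule ℝ (E d)) {δ : ℝ} (hδ : 0 < δ) :
    ∃ p : Successor Q (x.1 0) → ℝ, (∀ j, 0 ≤ p j) ∧ (∀ j, c j ≤ p j) ∧ ∑ j, p j = 1 ∧
      |(K x).real W.projectivization - ∑ j, p j *
        (K (append x j.1 j.2)).real (W.map (act (B (x.1 0) j.1))).projectivization| ≤ δ := by
  have hlim : Tendsto (fun n => ε n + ε (n + 1)) atTop (𝓝 0) := by
    simpa using hε0.add ((tendsto_add_atTop_iff_nat 1).mpr hε0)
  obtain ⟨n, hn⟩ := (hlim.eventually (gt_mem_nhds hδ)).exists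
  set a := ν.real (leftCylinder n x) with ha
  have ha0 : 0 < a := by
    refine ENNReal.toReal_pos (ne_of_gt ?_) (measure_ne_top _ _)
    exact (isOpen_leftCylinder n x).measure_pos _ ⟨x, mem_leftCylinder_self n x⟩
  set b : Successor Q (x.1 0) → ℝ := fun j => ν.real (leftCylinder (n + 1) (append x j.1 j.2))
    with hb
  have hinv' : ∀ W : Submodule ℝ (E d),
      (ν.compProd K).real (leftCylinder n x ×ˢ (W.projectivization : Set (RP d))) =
      ∑ j : Successor Q (x.1 0), (ν.compProd K).real (leftCylinder (n + 1) (append x j.1 j.2) ×ˢ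
        ((W.map (act (B (x.1 0) j.1))).projectivization : Set (RP d))) := fun W => by
    simp only [Measure.real]
    rw [hinv, ENNReal.toReal_sum fun j _ => measure_ne_top _ _]
  have htop : ∀ k y, (ν.compProd K).real
      (leftCylinder k y ×ˢ ((⊤ : Submodule ℝ (E d)).projectivization : Set (RP d))) =
      ν.real (leftCylinder k y) := fun k y => by
    have : ((⊤ : Submodule ℝ (E d)).projectivization : Set (RP d)) = Set.univ := by
      refine Set.eq_univ_of_forall fun p => ?_
      exact (Submodule.mem_projectivization_iff_submodule_le _ p).mpr le_top
    rw [this, Measure.real, Measure.compProd_apply_prod (measurableSet_leftCylinder k y) .univ]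
    simp [Measure.real]
  -- The invariance identity for the whole space.
  have hsum : ∑ j, b j = a := by
    have := hinv' ⊤
    simp only [map_act_top, htop] at this
    exact this.symm
  -- The weights are the conditional probabilities of the next symbol given the last `n + 1`
  -- symbols. They vary with `δ` through `n`; the lower bounds `c` do not.
  refine ⟨fun j => b j / a, fun j => by positivity, fun j => ?_, ?_, ?_⟩
  · exact (le_div_iff₀ ha0).mpr (hc j n)
  · rw [← Finset.sum_div, hsum, div_self ha0.ne']
  · set M := (K x).real W.projectivization with hM
    set N : Successor Q (x.1 0) → ℝ := fun j =>
      (K (append x j.1 j.2)).real (W.map (act (B (x.1 0) j.1))).projectivization with hN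
    have e1 := abs_compProd_leftCylinder_prod_sub_le (ν := ν) (K := K) hε
      (measurableSet_projectivization W) (hK _ (measurableSet_projectivization W)) n x
    have e2 : ∀ j : Successor Q (x.1 0), _ := fun j =>
      abs_compProd_leftCylinder_prod_sub_le (ν := ν) (K := K) hε
      (measurableSet_projectivization (W.map (act (B (x.1 0) j.1))))
      (hK _ (measurableSet_projectivization (W.map (act (B (x.1 0) j.1))))) (n + 1)
      (append x j.1 j.2)
    rw [hinv' W] at e1
    have e3 := (Finset.abs_sum_le_sum_abs _ _).trans
      (Finset.sum_le_sum fun j (_ : j ∈ Finset.univ) => e2 j)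
    rw [Finset.sum_sub_distrib, ← Finset.mul_sum] at e3
    change |_ - ∑ j, N j * b j| ≤ ε (n + 1) * ∑ j, b j at e3
    change |_ - M * a| ≤ ε n * a at e1
    rw [hsum] at e3
    have e4 : M - ∑ j, b j / a * N j = (M * a - ∑ j, N j * b j) / a := by
      rw [sub_div, mul_div_cancel_right₀ _ ha0.ne', Finset.sum_div]
      congr 1
      exact Finset.sum_congr rfl fun j _ => by ring
    change |M - ∑ j, b j / a * N j| ≤ δ
    rw [e4, abs_div, abs_of_pos ha0, div_le_iff₀ ha0]
    rw [abs_le] at e1 e3 ⊢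
    have : (ε n + ε (n + 1)) * a ≤ δ * a := by gcongr
    constructor <;> linarith

/-! ### Subspaces of maximal mass -/

/-- Distinct `l`-planes meet in lower dimension, hence in a null set, and a probability measure has
room for only finitely many almost disjoint sets of mass at least `δ`. -/
theorem finite_setOf_le_measure (P : Measure (RP d)) [IsProbabilityMeasure P] {l : ℕ}
    (h0 : ∀ W : Submodule ℝ (E d), Module.finrank ℝ W < l → P.real W.projectivization = 0)
    {δ : ℝ} (hδ : 0 < δ) :
    {W : Submodule ℝ (E d) | Module.finrank ℝ W = l ∧ δ ≤ P.real W.projectivization}.Finite := by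
  have hfin := Measure.finite_const_le_meas_of_disjoint_iUnion₀ P (ENNReal.ofReal_pos.mpr hδ)
    (As := fun W : {W : Submodule ℝ (E d) // Module.finrank ℝ W = l} =>
      (W.1.projectivization : Set (RP d)))
    (fun W => (measurableSet_projectivization W.1).nullMeasurableSet) ?_ (measure_ne_top _ _)
  · refine (hfin.image Subtype.val).subset ?_
    rintro W ⟨hW, hP⟩
    exact ⟨⟨W, hW⟩, (ENNReal.ofReal_le_iff_le_toReal (measure_ne_top _ _)).mpr hP, rfl⟩
  · rintro ⟨W₁, h₁⟩ ⟨W₂, h₂⟩ hne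
    have hlt : W₁ ⊓ W₂ < W₁ := by
      refine inf_lt_left.mpr fun hle => hne (Subtype.ext ?_)
      exact Submodule.eq_of_le_of_finrank_eq hle (h₁.trans h₂.symm)
    have hz := h0 _ ((Submodule.finrank_lt_finrank_of_lt hlt).trans_eq h₁)
    rw [measureReal_eq_zero_iff] at hz
    have hi : (W₁.projectivization : Set (RP d)) ∩ W₂.projectivization =
        (W₁ ⊓ W₂).projectivization := by
      ext p
      change p ∈ W₁.projectivization ∧ p ∈ W₂.projectivization ↔ p ∈ (W₁ ⊓ W₂).projectivization
      simp only [Submodule.mem_projectivization_iff_submodule_le, le_inf_iff]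
    change P ((W₁.projectivization : Set (RP d)) ∩ W₂.projectivization) = 0
    rwa [hi]

theorem compactSpace_leftSided (hQ : IsMixingAdjacency Q) : CompactSpace (LeftSided Q) :=
  (projLeft_surjective hQ).compactSpace continuous_projLeft

instance secondCountableTopology_leftSided : SecondCountableTopology (LeftSided Q) :=
  TopologicalSpace.Subtype.secondCountableTopology {y : ℕ → Fin q | ∀ n, Q (y (n + 1)) (y n) = 1}

section MaximalMass

variable {K : Kernel (LeftSided Q) (RP d)} {ε : ℕ → ℝ} {l : ℕ}

/-- Only the base points of a maximizing sequence need a limit: by the modulus, the same planes have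
almost maximal mass at the limit point, where finiteness provides a maximum. -/
theorem exists_maximal_mass [IsMarkovKernel K] (hQ : IsMixingAdjacency Q) (hε0 : Tendsto ε atTop (𝓝 0))
    (hK : ∀ W : Submodule ℝ (E d), ∀ n x, ∀ z ∈ leftCylinder n x,
      (K x).real W.projectivization ≤ (K z).real W.projectivization + ε n)
    (h0 : ∀ x, ∀ W : Submodule ℝ (E d), Module.finrank ℝ W < l →
      (K x).real W.projectivization = 0)
    (hpos : ∃ x, ∃ W : Submodule ℝ (E d), Module.finrank ℝ W = l ∧
      0 < (K x).real W.projectivization) :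
    ∃ γ : ℝ, 0 < γ ∧
      (∃ x, ∃ W : Submodule ℝ (E d), Module.finrank ℝ W = l ∧
        (K x).real W.projectivization = γ) ∧
      ∀ x, ∀ W : Submodule ℝ (E d), Module.finrank ℝ W = l →
        (K x).real W.projectivization ≤ γ := by
  have := compactSpace_leftSided hQ
  set S : Set ℝ := {r | ∃ x, ∃ W : Submodule ℝ (E d), Module.finrank ℝ W = l ∧
    (K x).real W.projectivization = r} with hS
  have hbdd : BddAbove S := ⟨1, by
    rintro r ⟨x, W, -, rfl⟩
    exact measureReal_le_one⟩
  have hle : ∀ x, ∀ W : Submodule ℝ (E d), Module.finrank ℝ W = l →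
      (K x).real W.projectivization ≤ sSup S := fun x W hW => le_csSup hbdd ⟨x, W, hW, rfl⟩
  obtain ⟨x₁, W₁, hW₁, hpos₁⟩ := hpos
  have hγ : 0 < sSup S := hpos₁.trans_le (hle x₁ W₁ hW₁)
  have happrox : ∀ n : ℕ, ∃ x, ∃ W : Submodule ℝ (E d), Module.finrank ℝ W = l ∧
      sSup S - 1 / ((n : ℝ) + 1) < (K x).real W.projectivization := fun n => by
    have hlt : sSup S - 1 / ((n : ℝ) + 1) < sSup S := sub_lt_self _ (by positivity)
    have hne : S.Nonempty := ⟨_, x₁, W₁, hW₁, rfl⟩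
    obtain ⟨r, ⟨x, W, hW, rfl⟩, hr⟩ := exists_lt_of_lt_csSup hne hlt
    exact ⟨x, W, hW, hr⟩
  choose u U hU hu using happrox
  obtain ⟨x, φ, hφ, hx⟩ := CompactSpace.tendsto_subseq u
  have hnear : ∀ δ > 0, ∃ W : Submodule ℝ (E d), Module.finrank ℝ W = l ∧
      sSup S - δ ≤ (K x).real W.projectivization := by
    intro δ hδ
    obtain ⟨k, hk⟩ := (hε0.eventually (gt_mem_nhds (half_pos hδ))).exists
    have h1 : ∀ᶠ n in atTop, u (φ n) ∈ leftCylinder k x :=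
      hx.eventually ((isOpen_leftCylinder k x).mem_nhds (mem_leftCylinder_self k x))
    have h2 : ∀ᶠ n in atTop, 1 / ((φ n : ℝ) + 1) < δ / 2 :=
      (tendsto_one_div_add_atTop_nhds_zero_nat.comp hφ.tendsto_atTop).eventually
        (gt_mem_nhds (half_pos hδ))
    obtain ⟨n, hn1, hn2⟩ := (h1.and h2).exists
    refine ⟨U (φ n), hU _, ?_⟩
    have h3 := hK (U (φ n)) k (u (φ n)) x (mem_leftCylinder_symm hn1)
    have h4 := hu (φ n)
    linarith
  set F := {W : Submodule ℝ (E d) | Module.finrank ℝ W = l ∧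
    sSup S / 2 ≤ (K x).real W.projectivization} with hF
  have hFfin : F.Finite := finite_setOf_le_measure (K x) (h0 x) (half_pos hγ)
  have hFne : F.Nonempty := by
    obtain ⟨W, hW, hm⟩ := hnear (sSup S / 2) (half_pos hγ)
    exact ⟨W, hW, by linarith⟩
  obtain ⟨W, hWF, hmax⟩ := Set.exists_max_image F
    (fun W => (K x).real W.projectivization) hFfin hFne
  refine ⟨sSup S, hγ, ⟨x, W, hWF.1, le_antisymm (hle x W hWF.1) ?_⟩, hle⟩
  refine le_of_forall_pos_le_add fun δ hδ => ?_
  obtain ⟨W', hW', hm⟩ := hnear (min δ (sSup S / 2)) (lt_min hδ (half_pos hγ))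
  have h5 : W' ∈ F := ⟨hW', by linarith [min_le_right δ (sSup S / 2)]⟩
  have h6 := hmax W' h5
  linarith [min_le_left δ (sSup S / 2)]

variable {B : Fin q → Fin q → Matrix.GeneralLinearGroup (Fin d) ℝ} {γ : ℝ}

theorem finrank_map_act (g : Matrix.GeneralLinearGroup (Fin d) ℝ) (W : Submodule ℝ (E d)) :
    Module.finrank ℝ (W.map (act g)) = Module.finrank ℝ W :=
  (Submodule.equivMapOfInjective (act g) (act_injective g) W).finrank_eq.symm

/-- Self-similarity of the family of measures `K x` up to arbitrarily small errors. -/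
def IsApproxSelfSimilar (K : Kernel (LeftSided Q) (RP d))
    (B : Fin q → Fin q → Matrix.GeneralLinearGroup (Fin d) ℝ) : Prop :=
  ∀ x : LeftSided Q, ∃ c : Successor Q (x.1 0) → ℝ, (∀ j, 0 < c j) ∧
    ∀ (W : Submodule ℝ (E d)) (δ : ℝ), 0 < δ →
      ∃ p : Successor Q (x.1 0) → ℝ, (∀ j, 0 ≤ p j) ∧ (∀ j, c j ≤ p j) ∧ ∑ j, p j = 1 ∧
        |(K x).real W.projectivization - ∑ j, p j *
          (K (append x j.1 j.2)).real (W.map (act (B (x.1 0) j.1))).projectivization| ≤ δ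

/-- Mass `γ` is inherited by the successors. -/
theorem IsApproxSelfSimilar.maximal_append (hJ : IsApproxSelfSimilar K B)
    (hmax : ∀ x, ∀ W : Submodule ℝ (E d), Module.finrank ℝ W = l →
        (K x).real W.projectivization ≤ γ)
    {x : LeftSided Q} {W : Submodule ℝ (E d)} (hW : Module.finrank ℝ W = l)
    (hx : (K x).real W.projectivization = γ) (j : Successor Q (x.1 0)) :
    (K (append x j.1 j.2)).real (W.map (act (B (x.1 0) j.1))).projectivization = γ := by
  set N : Successor Q (x.1 0) → ℝ := fun j =>
    (K (append x j.1 j.2)).real (W.map (act (B (x.1 0) j.1))).projectivization with hN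
  have hNle : ∀ j, N j ≤ γ := fun j => hmax _ _ ((finrank_map_act _ W).trans hW)
  obtain ⟨c, hc, hJx⟩ := hJ x
  refine le_antisymm (hNle j) ?_
  by_contra! hlt
  change N j < γ at hlt
  -- A deficit at `j` costs the average at least `c j * (γ - N j)`; an error of half that size
  -- cannot hide it.
  obtain ⟨p, hp0, hpc, hp1, hp⟩ := hJx W (c j * (γ - N j) / 2)
    (half_pos (mul_pos (hc j) (sub_pos.mpr hlt)))
  change |_ - ∑ j, p j * N j| ≤ _ at hp
  have e : γ - ∑ j, p j * N j = ∑ j, p j * (γ - N j) := by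
    simp only [mul_sub, Finset.sum_sub_distrib, ← Finset.sum_mul, hp1, one_mul]
  rw [hx, e] at hp
  have h1 : p j * (γ - N j) ≤ ∑ j, p j * (γ - N j) :=
    Finset.single_le_sum (f := fun j => p j * (γ - N j))
      (fun i _ => mul_nonneg (hp0 i) (sub_nonneg.mpr (hNle i))) (Finset.mem_univ j)
  have h2 : c j * (γ - N j) ≤ p j * (γ - N j) :=
    mul_le_mul_of_nonneg_right (hpc j) (sub_nonneg.mpr hlt.le)
  have h3 := (abs_le.mp hp).2
  have h4 : 0 < c j * (γ - N j) := mul_pos (hc j) (sub_pos.mpr hlt)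
  linarith

/-- Whether a subspace has mass `γ` depends only on the zeroth symbol. -/
theorem IsApproxSelfSimilar.maximal_of_eq (hJ : IsApproxSelfSimilar K B)
    (hε0 : Tendsto ε atTop (𝓝 0))
    (hK : ∀ W : Submodule ℝ (E d), ∀ n x, ∀ z ∈ leftCylinder n x,
      (K x).real W.projectivization ≤ (K z).real W.projectivization + ε n)
    (hmax : ∀ x, ∀ W : Submodule ℝ (E d), Module.finrank ℝ W = l →
        (K x).real W.projectivization ≤ γ)
    {x z : LeftSided Q} (hxz : z.1 0 = x.1 0) {W : Submodule ℝ (E d)}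
    (hW : Module.finrank ℝ W = l) (hx : (K x).real W.projectivization = γ) :
    (K z).real W.projectivization = γ := by
  refine le_antisymm (hmax z W hW) (le_of_forall_pos_le_add fun δ hδ => ?_)
  obtain ⟨N, hN⟩ := (hε0.eventually (gt_mem_nhds hδ)).exists
  -- Each common symbol appended improves the agreement by one place, until the modulus at level `N`
  -- applies. A lower bound at all successors then passes back to `z` by averaging, with no loss as
  -- `k` grows.
  have key : ∀ k, ∀ x z : LeftSided Q, z ∈ leftCylinder (N - k) x → ∀ W : Submodule ℝ (E d),
      Module.finrank ℝ W = l → (K x).real W.projectivization = γ →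
      γ - δ ≤ (K z).real W.projectivization := by
    intro k
    induction k with
    | zero =>
      intro x z hxz W hW hx
      have := hK W N x z hxz
      linarith
    | succ k ih =>
      intro x z hxz W hW hx
      have hz0 : z.1 0 = x.1 0 := hxz 0 (Nat.zero_le _)
      obtain ⟨c, -, hJz⟩ := hJ z
      have hge : ∀ j : Successor Q (z.1 0), γ - δ ≤
          (K (append z j.1 j.2)).real (W.map (act (B (z.1 0) j.1))).projectivization := by
        rintro ⟨j, hj⟩
        have hj' : Q (x.1 0) j = 1 := hz0 ▸ hj
        refine ih (append x j hj') _ ?_ _ ((finrank_map_act _ W).trans hW) ?_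
        · intro i hi
          rcases i with _ | i
          · rfl
          · exact hxz i (by omega)
        · rw [show B (z.1 0) j = B (x.1 0) j by rw [hz0]]
          exact hJ.maximal_append hmax hW hx ⟨j, hj'⟩
      refine le_of_forall_pos_le_add fun η hη => ?_
      obtain ⟨p, hp0, -, hp1, hp⟩ := hJz W η hη
      have h1 : ∑ j, p j * (γ - δ) ≤ ∑ j, p j *
          (K (append z j.1 j.2)).real (W.map (act (B (z.1 0) j.1))).projectivization :=
        Finset.sum_le_sum fun j _ => mul_le_mul_of_nonneg_left (hge j) (hp0 j)
      rw [← Finset.sum_mul, hp1, one_mul] at h1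
      linarith [(abs_le.mp hp).1]
  have := key N x z (fun i hi => by
    obtain rfl : i = 0 := by omega
    exact hxz) W hW hx
  linarith

/-- Strong irreducibility forbids mass on proper subspaces. -/
theorem measureReal_projectivization_eq_zero [IsMarkovKernel K] (hQ : IsMixingAdjacency Q)
    {A : TwoSided Q → Matrix.GeneralLinearGroup (Fin d) ℝ} (hA : IsTwoStep A)
    (hirr : IsStronglyIrreducible A) (hJ : IsApproxSelfSimilar K (transition A))
    (hε0 : Tendsto ε atTop (𝓝 0))
    (hK : ∀ W : Submodule ℝ (E d), ∀ n x, ∀ z ∈ leftCylinder n x,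
      (K x).real W.projectivization ≤ (K z).real W.projectivization + ε n)
    (x : LeftSided Q) {W : Submodule ℝ (E d)} (hW : W ≠ ⊤) :
    (K x).real W.projectivization = 0 := by
  classical
  by_contra hne
  have hex : ∃ l, ∃ x, ∃ W : Submodule ℝ (E d), Module.finrank ℝ W = l ∧
      0 < (K x).real W.projectivization :=
    ⟨_, x, W, rfl, lt_of_le_of_ne measureReal_nonneg (Ne.symm hne)⟩
  set l := Nat.find hex with hl
  have hlmin : ∀ x, ∀ W : Submodule ℝ (E d), Module.finrank ℝ W < l →
      (K x).real W.projectivization = 0 := fun x W h => by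
    by_contra hne
    exact Nat.find_min hex h ⟨x, W, rfl, lt_of_le_of_ne measureReal_nonneg (Ne.symm hne)⟩
  have hld : l < d := by
    have h1 : l ≤ Module.finrank ℝ W := by
      by_contra! h
      exact hne (hlmin x W h)
    have h2 := Submodule.finrank_lt hW
    rw [finrank_euclideanSpace_fin] at h2
    omega
  obtain ⟨γ, hγ, ⟨x₁, W₁, hW₁, hx₁⟩, hmax⟩ :=
    exists_maximal_mass hQ hε0 hK hlmin (Nat.find_spec hex)
  have hl1 : 1 ≤ l := by
    rw [Nat.one_le_iff_ne_zero]
    intro h0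
    rw [h0, Submodule.finrank_eq_zero] at hW₁
    have : ((⊥ : Submodule ℝ (E d)).projectivization : Set (RP d)) = ∅ := by
      refine Set.eq_empty_of_forall_notMem fun p => ?_
      induction p using Projectivization.ind with
      | h v hv => exact fun h => hv ((Submodule.mk_mem_projectivization_iff _ hv).mp h)
    rw [hW₁, this, measureReal_empty] at hx₁
    exact hγ.ne hx₁
  -- Mass `γ` at one past ending in `ξ` is mass `γ` at all of them, so `V ξ` is finite and serves as
  -- the invariant family.
  set V : Fin q → Set (Submodule ℝ (E d)) := fun ξ =>
    {W | Module.finrank ℝ W = l ∧ ∃ x : LeftSided Q, x.1 0 = ξ ∧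
      (K x).real W.projectivization = γ} with hV
  have hVfin : ∀ ξ, (V ξ).Finite := fun ξ => by
    obtain ⟨z, hz⟩ := exists_leftSided hQ ξ
    refine (finite_setOf_le_measure (K z) (hlmin z) hγ).subset ?_
    rintro W ⟨hW, y, hy, hyW⟩
    exact ⟨hW, (hJ.maximal_of_eq hε0 hK hmax (hz.trans hy.symm) hW hyW).ge⟩
  have hmaps : ∀ i j, Q i j = 1 →
      (Submodule.map (act (transition A i j))) '' V i ⊆ V j := by
    rintro i j hij _ ⟨W, ⟨hW, y, rfl, hyW⟩, rfl⟩
    exact ⟨(finrank_map_act _ W).trans hW, append y j hij, rfl,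
      hJ.maximal_append hmax hW hyW ⟨j, hij⟩⟩
  have hinj : ∀ i j, Function.Injective (Submodule.map (act (transition A i j))) := fun i j =>
    Submodule.map_injective_of_injective (act_injective _)
  have hcard : ∀ i j, Q i j = 1 → (V i).ncard ≤ (V j).ncard := fun i j hij => by
    rw [← Set.ncard_image_of_injective (V i) (hinj i j)]
    exact Set.ncard_le_ncard (hmaps i j hij) (hVfin j)
  have : Nonempty (Fin q) := ⟨x₁.1 0⟩
  -- Cardinality does not decrease along transitions, so the symbols of maximal cardinality are
  -- closed under successors and exhaust the alphabet. The injections between the `V i` are then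
  -- bijections.
  obtain ⟨i₀, hi₀⟩ := Finite.exists_max fun i => (V i).ncard
  have hall : ∀ i, (V i).ncard = (V i₀).ncard := fun i => by
    have huniv := hQ.eq_univ_of_closed (S := {i | (V i₀).ncard ≤ (V i).ncard})
      ⟨i₀, le_refl (V i₀).ncard⟩ fun i hi j hij => le_trans hi (hcard i j hij)
    exact le_antisymm (hi₀ i) (huniv.symm ▸ Set.mem_univ i :
      i ∈ {i | (V i₀).ncard ≤ (V i).ncard})
  have heq : ∀ i j, Q i j = 1 → (Submodule.map (act (transition A i j))) '' V i = V j :=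
    fun i j hij => Set.eq_of_subset_of_ncard_le (hmaps i j hij)
      (by rw [Set.ncard_image_of_injective _ (hinj i j), hall i, hall j]) (hVfin j)
  have hone : 1 ≤ (V i₀).ncard := by
    rw [← hall (x₁.1 0), Nat.one_le_iff_ne_zero]
    exact (Set.ncard_pos (hVfin _)).mpr ⟨W₁, hW₁, x₁, rfl, hx₁⟩ |>.ne'
  have henum : ∀ i, ∃ e : Fin (V i₀).ncard → Submodule ℝ (E d), Set.range e = V i := fun i => by
    have : Finite (V i) := hVfin i
    let e := (Finite.equivFinOfCardEq (α := V i) (hall i)).symm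
    refine ⟨fun k => (e k).1, ?_⟩
    rw [show (fun k => (e k).1) = Subtype.val ∘ e from rfl, Set.range_comp, e.range_eq_univ,
      Set.image_univ, Subtype.range_coe]
  choose e he using henum
  refine hirr ⟨l, (V i₀).ncard, fun k x => e (x.1 0) k, hl1, hld, hone, fun k x => ?_,
    fun k x y hxy => by simp only [hxy], fun x => ?_⟩
  · have : e (x.1 0) k ∈ V (x.1 0) := he (x.1 0) ▸ Set.mem_range_self k
    exact this.1
  · have hU : ∀ i, (⋃ k, (e i k : Set (E d))) = ⋃ W ∈ V i, (W : Set (E d)) := fun i => by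
      rw [← he i, Set.biUnion_range]
    change act (A x) '' (⋃ k, (e (x.1 0) k : Set (E d))) = ⋃ k, (e (x.1 1) k : Set (E d))
    rw [hU, hU, ← heq (x.1 0) (x.1 1) (x.2 0), Set.biUnion_image, Set.image_iUnion₂,
      hA.eq_transition x]
    rfl

end MaximalMass

/-! ### Continuity and uniqueness of the disintegration -/

theorem continuous_integral_of_modulus {K : Kernel (LeftSided Q) (RP d)} [IsMarkovKernel K]
    {ε : ℕ → ℝ} (hε : ∀ n, 0 ≤ ε n) (hε0 : Tendsto ε atTop (𝓝 0))
    (hK : ∀ f : RP d → ENNReal, Measurable f → (∀ v, f v ≤ 1) → ∀ n x, ∀ z ∈ leftCylinder n x,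
      ∫⁻ v, f v ∂(K x) ≤ ∫⁻ v, f v ∂(K z) + ENNReal.ofReal (ε n)) (g : C(RP d, ℝ)) :
    Continuous fun x => ∫ v, g v ∂(K x) := by
  have hint : ∀ (h : C(RP d, ℝ)) x, Integrable h (K x) := fun h x =>
    Integrable.of_bound h.continuous.aestronglyMeasurable ‖h‖ (ae_of_all _ h.norm_coe_le_norm)
  have key : ∀ h : C(RP d, ℝ), (∀ v, 0 ≤ h v) → (∀ v, h v ≤ 1) →
      Continuous fun x => ∫ v, h v ∂(K x) := by
    intro h h0 h1
    have hle : ∀ n x, ∀ z ∈ leftCylinder n x,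
        ∫ v, h v ∂(K x) ≤ ∫ v, h v ∂(K z) + ε n := by
      intro n x z hz
      have hm := hK (fun v => ENNReal.ofReal (h v)) h.continuous.measurable.ennreal_ofReal
        (fun v => ENNReal.ofReal_le_one.mpr (h1 v)) n x z hz
      rw [← ofReal_integral_eq_lintegral_ofReal (hint h x) (ae_of_all _ h0),
        ← ofReal_integral_eq_lintegral_ofReal (hint h z) (ae_of_all _ h0),
        ← ENNReal.ofReal_add (integral_nonneg h0) (hε n)] at hm
      exact (ENNReal.ofReal_le_ofReal_iff (add_nonneg (integral_nonneg h0) (hε n))).mp hm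
    refine continuous_iff_continuousAt.mpr fun x => Metric.continuousAt_iff'.mpr fun δ hδ => ?_
    obtain ⟨n, hn⟩ := (hε0.eventually (gt_mem_nhds hδ)).exists
    filter_upwards [(isOpen_leftCylinder n x).mem_nhds (mem_leftCylinder_self n x)] with z hz
    have e1 := hle n x z hz
    have e2 := hle n z x (mem_leftCylinder_symm hz)
    rw [Real.dist_eq, abs_lt]
    constructor <;> linarith
  -- Affine rescaling of `g` into `[0, 1]`; the `+ 1` keeps `c` positive when `g = 0`.
  set c := 2 * ‖g‖ + 1 with hc
  have hc0 : 0 < c := by positivity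
  have hb : ∀ v, |g v| ≤ ‖g‖ := g.norm_coe_le_norm
  let h : C(RP d, ℝ) := ⟨fun v => (g v + ‖g‖) / c, by fun_prop⟩
  have hcont := key h
    (fun v => div_nonneg (by linarith [(abs_le.mp (hb v)).1]) hc0.le)
    (fun v => (div_le_one hc0).mpr (by linarith [(abs_le.mp (hb v)).2, norm_nonneg g]))
  have e : (fun x => ∫ v, g v ∂(K x)) = fun x => c * ∫ v, h v ∂(K x) - ‖g‖ := by
    funext x
    have : ∀ v, g v = c * h v - ‖g‖ := fun v => by
      change g v = c * ((g v + ‖g‖) / c) - ‖g‖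
      field_simp
      ring
    simp_rw [this]
    rw [integral_sub ((hint h x).const_mul c) (integrable_const _), integral_const_mul]
    simp
  rw [e]
  exact (continuous_const.mul hcont).sub continuous_const

/-- Integrals of a continuous function against the two kernels agree almost everywhere, hence
everywhere by continuity and full support. The nonnegative functions `bump` then give the mass of a
subspace in the limit. -/
theorem measureReal_projectivization_unique {ν : Measure (LeftSided Q)} [IsProbabilityMeasure ν]
    [ν.IsOpenPosMeasure] {κ₁ κ₂ : Kernel (LeftSided Q) (RP d)} [IsMarkovKernel κ₁]
    [IsMarkovKernel κ₂] (h : ν.compProd κ₁ = ν.compProd κ₂)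
    (h₁ : ∀ g : C(RP d, ℝ), Continuous fun x => ∫ v, g v ∂(κ₁ x))
    (h₂ : ∀ g : C(RP d, ℝ), Continuous fun x => ∫ v, g v ∂(κ₂ x))
    (x : LeftSided Q) (W : Submodule ℝ (E d)) :
    (κ₁ x).real W.projectivization = (κ₂ x).real W.projectivization := by
  have hint : ∀ g : C(RP d, ℝ), (∀ v, 0 ≤ g v) → ∫ v, g v ∂(κ₁ x) = ∫ v, g v ∂(κ₂ x) := by
    intro g hg
    have hm : Measurable fun v => ENNReal.ofReal (g v) := g.continuous.measurable.ennreal_ofReal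
    have hae : (fun x => ∫⁻ v, ENNReal.ofReal (g v) ∂(κ₁ x)) =ᵐ[ν]
        fun x => ∫⁻ v, ENNReal.ofReal (g v) ∂(κ₂ x) := by
      refine ae_eq_of_forall_setLIntegral_eq_of_sigmaFinite hm.lintegral_kernel
        hm.lintegral_kernel fun S hS _ => ?_
      have key : ∀ (κ : Kernel (LeftSided Q) (RP d)) [IsMarkovKernel κ],
          ∫⁻ x in S, ∫⁻ v, ENNReal.ofReal (g v) ∂(κ x) ∂ν =
            ∫⁻ p, S.indicator 1 p.1 * ENNReal.ofReal (g p.2) ∂(ν.compProd κ) := by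
        intro κ _
        have hf : Measurable fun p : LeftSided Q × RP d =>
            S.indicator (1 : LeftSided Q → ENNReal) p.1 * ENNReal.ofReal (g p.2) :=
          ((measurable_one.indicator hS).comp measurable_fst).mul (hm.comp measurable_snd)
        rw [Measure.lintegral_compProd hf, ← lintegral_indicator hS]
        refine lintegral_congr fun x => ?_
        by_cases hx : x ∈ S <;> simp [hx]
      rw [key κ₁, key κ₂, h]
    have hae' : (fun x => ∫ v, g v ∂(κ₁ x)) =ᵐ[ν] fun x => ∫ v, g v ∂(κ₂ x) := by
      filter_upwards [hae] with y hy
      rw [integral_eq_lintegral_of_nonneg_ae (ae_of_all _ hg) g.continuous.aestronglyMeasurable,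
        integral_eq_lintegral_of_nonneg_ae (ae_of_all _ hg) g.continuous.aestronglyMeasurable, hy]
    exact congrFun (((h₁ g).ae_eq_iff_eq ν (h₂ g)).mp hae') x
  have hlim : ∀ (P : Measure (RP d)) [IsProbabilityMeasure P],
      Tendsto (fun n => ∫ v, bump W n v ∂P) atTop (𝓝 (P.real W.projectivization)) := by
    intro P _
    rw [← integral_indicator_one (measurableSet_projectivization W)]
    refine tendsto_integral_of_dominated_convergence (fun _ => 1)
      (fun n => (bump W n).continuous.aestronglyMeasurable) (integrable_const _)
      (fun n => ae_of_all _ fun v => ?_) (ae_of_all _ (tendsto_bump W))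
    rw [Real.norm_eq_abs, abs_of_nonneg (bump_nonneg W n v)]
    exact bump_le_one W n v
  refine tendsto_nhds_unique (hlim (κ₁ x)) ((hlim (κ₂ x)).congr fun n => ?_)
  exact (hint (bump W n) (bump_nonneg W n)).symm

end ShiftCocycle

end

/-! ### Conclusion of the argument -/

theorem mainTheorem3 {q d : ℕ} (Q : Matrix (Fin q) (Fin q) ℤ)
    (hQ : ShiftCocycle.IsMixingAdjacency Q)
    (μ : Measure (ShiftCocycle.TwoSided Q)) [IsProbabilityMeasure μ] [μ.IsOpenPosMeasure]
    (hμ : ShiftCocycle.HasHolderProductStructure μ)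
    (A : ShiftCocycle.TwoSided Q → Matrix.GeneralLinearGroup (Fin d) ℝ)
    (hA : ShiftCocycle.IsTwoStep A)
    (hirr : ShiftCocycle.IsStronglyIrreducible A)
    (hsimple : ShiftCocycle.HasSimpleTopExponent μ A)
    (m : Measure (ShiftCocycle.TwoSided Q × ShiftCocycle.RP d))
    (hm : ShiftCocycle.IsInvariantSState μ A m) :
    (∃ κ : Kernel (ShiftCocycle.LeftSided Q) (ShiftCocycle.RP d),
      ShiftCocycle.IsContinuousDisintegration (ShiftCocycle.projectMeasure m) κ) ∧
    ∀ κ : Kernel (ShiftCocycle.LeftSided Q) (ShiftCocycle.RP d),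
      ShiftCocycle.IsContinuousDisintegration (ShiftCocycle.projectMeasure m) κ →
      ∀ (x : ShiftCocycle.LeftSided Q)
        (V : Projectivization.Subspace ℝ (ShiftCocycle.E d)),
        V ≠ ⊤ → κ x (V : Set (ShiftCocycle.RP d)) = 0 := by
  open ShiftCocycle in
  have hne : Nonempty (TwoSided Q) := nonempty_of_isProbabilityMeasure μ
  obtain ⟨ψ, hψ, hpos, hhol, hdens⟩ := hμ.exists_density
  have hdens : HasProductDensity μ ψ := hdens
  obtain ⟨ε, hε, hε0, hmod⟩ := hhol.exists_modulus
  obtain ⟨κ₀, hκ₀, hmκ, hst⟩ := hm.exists_disintegration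
  have hst : IsStableKernel κ₀ := hst
  set K := pastKernel μ ψ κ₀ with hKdef
  have : IsMarkovKernel K :=
    ⟨fun x => ⟨pastKernel_univ hQ hdens hψ.measurable hst hε0 hmod x⟩⟩
  have := isOpenPosMeasure_map_projLeft (μ := μ) hQ
  have hproj : projectMeasure m = (μ.map projLeft).compProd K := by
    ext s hs
    rw [hmκ, projectMeasure_apply hdens hψ.measurable hs, Measure.compProd_apply hs]
  have hfst : (projectMeasure m).map Prod.fst = μ.map projLeft := by
    rw [hproj]
    exact Measure.fst_compProd _ _
  have hcont : ∀ g : C(RP d, ℝ), Continuous fun x => ∫ v, g v ∂(K x) :=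
    continuous_integral_of_modulus hε hε0 fun f hf hf1 n x z hz =>
      lintegral_pastKernel_le_add hψ.measurable hst hmod hz hf hf1
  refine ⟨⟨K, inferInstance, by rw [hfst, hproj], hcont⟩, fun κ hκ x V hV => ?_⟩
  have hKs : ∀ s : Set (RP d), MeasurableSet s → ∀ n x, ∀ z ∈ leftCylinder n x,
      K x s ≤ K z s + ENNReal.ofReal (ε n) := fun s hs n x z hz =>
    pastKernel_apply_le_add hψ.measurable hst hmod hz hs
  have hKr : ∀ W : Submodule ℝ (E d), ∀ n x, ∀ z ∈ leftCylinder n x,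
      (K x).real W.projectivization ≤ (K z).real W.projectivization + ε n := by
    intro W n x z hz
    have h := ENNReal.toReal_mono (by finiteness)
      (hKs _ (measurableSet_projectivization W) n x z hz)
    rwa [ENNReal.toReal_add (by finiteness) (by finiteness), ENNReal.toReal_ofReal (hε n)] at h
  have hJ : IsApproxSelfSimilar K (transition A) := by
    intro y
    choose c hc0 hc using fun j : Successor Q (y.1 0) =>
      exists_le_leftCylinder_append hQ hμ.ergodic.toMeasurePreserving hdens hψ hpos y j.1 j.2
    refine ⟨c, hc0, fun W δ hδ => exists_weights hε hε0 hKs (fun n y W => ?_) hc W hδ⟩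
    rw [← hproj]
    exact projectMeasure_leftCylinder_prod hA hm n y W
  have := hκ.isMarkov
  have hW : Projectivization.Subspace.submodule V ≠ ⊤ := by simpa using hV
  have hVW : V = (Projectivization.Subspace.submodule V).projectivization :=
    (Projectivization.Subspace.submodule.symm_apply_apply V).symm
  -- The vanishing is proved for `K` and carried over to the given `κ` by uniqueness.
  have h1 := measureReal_projectivization_eq_zero hQ hA hirr hJ hε0 hKr x hW
  have hdis := hκ.disintegrates
  rw [hfst, hproj] at hdis
  rw [measureReal_projectivization_unique hdis hcont hκ.continuous, ← hVW] at h1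
  exact (measureReal_eq_zero_iff).mp h1
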